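/- **Theorem (termination-insensitive non-interference for $\lambda^{\mathrm{LIO}}_{\mathcal L,\mathrm{FS}}$).** Let $\mathcal L$ be a lattice of labels with order $\sqsubseteq$. *The calculus.* $\lambda^{\mathrm{LIO}}_{\mathcal L,\mathrm{FS}}$ is the simply typed call-by-name $\lambda$-calculus with $\mathsf{fix}$, Booleans, unit, labels and the label operations $\sqcup,\sqcap,\sqsubseteq$, a monad $\mathrm{LIO}$ ($\mathsf{return}$, $\gg\!=$, $\mathsf{getLabel}$), labeled values ($\mathsf{label},\mathsf{unlabel},\mathsf{labelOf},\mathsf{toLabeled}$), flow-insensitive references ($\mathsf{newRef}$, $\mathsf{readRef}$, $\mathsf{writeRef}$, $\mathsf{labelOf}$, $\mathsf{copyRef}$), flow-sensitive references ($\mathsf{newRef}$, $\mathsf{readRef}$, $\mathsf{writeRef}$, $\mathsf{labelOf}$, $\mathsf{upgrade}$, $\mathsf{downgrade}$) and a divergent term $\Uparrow$. Its internal (TCB) nodes are monadic values $\mathrm{LIO}\,t$, labeled values $\mathrm{Lb}\,l\,t$, and references $\mathrm{Ref}_{\mathrm{FI}}\,l\,a$, $\mathrm{Ref}_{\mathrm{FS}}\,a$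 to an address $a$. A configuration $\langle\Sigma\mid t\rangle$ consists of a term and an environment $\Sigma=(l_{\mathrm{cur}},\mu_{\mathrm{FI}},\mu_{\mathrm{FS}})$, where $l_{\mathrm{cur}}$ is the current label and the stores are partial maps from addresses to values $\mathrm{Lb}\,l\,t$ and $\mathrm{Lb}\,l_o\,(\mathrm{Lb}\,l_d\,t)$ respectively. The small-step reduction $\longrightarrow$ has the following side conditions and effects on $\Sigma$. $\mathsf{label}\,l\,t$ and both forms of $\mathsf{newRef}\,l\,t$ require $l_{\mathrm{cur}}\sqsubseteq l$; $\mathsf{newRef}$ picks any address outside both stores and binds it to $\mathrm{Lb}\,l\,t$ (FI) or $\mathrm{Lb}\,l_{\mathrm{cur}}\,(\mathrm{Lb}\,l\,t)$ (FS). $\mathsf{unlabel}\,(\mathrm{Lb}\,l\,t)$ returns $t$ and raises $l_{\mathrm{cur}}$ to $l_{\mathrm{cur}}\sqcup l$. $\mathsf{toLabeled}\,l\,t$ requires $l_{\mathrm{cur}}\sqsubseteq l$, runs $t$ to some $\mathrm{LIO}\,t'$ ending with current label $l'_{\mathrm{cur}}\sqsubseteq l$, keeps the resulting stores, restores $l_{\mathrm{cur}}$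 and continues as $\mathsf{label}\,l\,t'$. Reading an FI reference unlabels its binding; writing through $\mathrm{Ref}_{\mathrm{FI}}\,l\,a$ requires $l_{\mathrm{cur}}\sqsubseteq l$; $\mathsf{copyRef}$ from $\mathrm{Ref}_{\mathrm{FI}}\,l_1\,a_1$ to $\mathrm{Ref}_{\mathrm{FI}}\,l_2\,a_2$ requires $l_1\sqsubseteq l_2$ and $l_{\mathrm{cur}}\sqsubseteq l_2$. For an FS reference bound to $\mathrm{Lb}\,l_o\,(\mathrm{Lb}\,l_d\,t)$: reading unlabels $\mathrm{Lb}\,(l_o\sqcup l_d)\,t$; taking its label unlabels $\mathrm{Lb}\,l_o\,l_d$; writing replaces $t$ if $l_{\mathrm{cur}}\sqsubseteq l_o\sqcup l_d$ and otherwise becomes $\mathsf{unlabel}\,(\mathrm{Lb}\,l_o\Uparrow)$; upgrading and downgrading with $l$ require $l_{\mathrm{cur}}\sqsubseteq l_o$ and set the binding to $\mathrm{Lb}\,l_o\,(\mathrm{Lb}\,(l_d\sqcup l)\,t)$ and $\mathrm{Lb}\,l_o\,(\mathrm{Lb}\,(l_o\sqcup(l_d\sqcap l))\Uparrow)$. The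 remaining rules are the standard ones. *$l$-equivalence.* The $l$-erasure of a term replaces by $\bullet$ the content $t$ of every $\mathrm{Lb}\,l'\,t$ with $l'\not\sqsubseteq l$. Two terms are $l$-equivalent, $t_1\approx_l t_2$, if their $l$-erasures are syntactically equal. The $l$-erasure of a configuration deletes the current label and the term if $l_{\mathrm{cur}}\not\sqsubseteq l$, deletes the bindings of $\mu_{\mathrm{FI}}$ and $\mu_{\mathrm{FS}}$ whose outermost label does not flow to $l$, and erases all remaining terms and bindings. Two configurations are $l$-equivalent if their $l$-erasures are syntactically equal up to a bijective renaming of addresses. *Statement.* Let $l\in\mathcal L$ be the attacker's observation level, let $\Sigma$ be an environment whose stores are well typed by a store typing $\Delta$ (with the same domains), and let $t_1,t_2$ be terms that are well typed under $\Delta$ and a type environment $\Gamma$ and contain no node $\mathrm{Ref}_{\mathrm{FI}}\,l'\,a$ or $\mathrm{Ref}_{\mathrm{FS}}\,a$ (in particular, they may be any well-typed terms without TCB nodes). Suppose that $t_1\approx_l t_2$ and that $$\langle\Sigma\mid t_1\rangle\longrightarrow^*\langle\Sigma_1\mid v_1\rangle\quad\text{and}\quad\langle\Sigma\mid t_2\rangle\longrightarrow^*\langle\Sigma_2\mid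 v_2\rangle$$ with values $v_1,v_2$. Then $\langle\Sigma_1\mid v_1\rangle\approx_l\langle\Sigma_2\mid v_2\rangle$, by a renaming that fixes all addresses allocated in $\Sigma$. -/

import Mathlib

/-! # The calculus `λ^LIO_{L,FS}`: LIO with flow-insensitive and flow-sensitive references

The calculus is parametric in a lattice `L` of labels; `⊑`, `⊔`, `⊓` are `≤`, `⊔`, `⊓` of `L`.
Variables are de Bruijn indices, so that syntactic equality of terms is equality up to renaming
of bound variables. -/

namespace FloatingLabel

universe u

/-- Memory addresses. -/
abbrev Addr : Type := ℕ

/-- The index `s` of the reference operations: flow-insensitive or flow-sensitive. -/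
inductive RefKind : Type
  | fi
  | fs

/-- The label operations `⊔`, `⊓`, `⊑`. -/
inductive LabelOp : Type
  | join
  | meet
  | flows

/-- Types. -/
inductive Ty : Type
  | bool
  | unit
  | arrow (τ σ : Ty)
  | label
  | lio (τ : Ty)
  | labeled (τ : Ty)
  | ref (s : RefKind) (τ : Ty)

/-- The type of a label operation applied to two labels. -/
def LabelOp.resultTy : LabelOp → Ty
  | .join => .label
  | .meet => .label
  | .flows => .bool

/-- Terms. The nodes marked TCB are internal to the semantics and not available to programmers. -/
inductive Term (L : Type*) : Type _
  | bool (b : Bool)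
  | unit
  | lam (t : Term L)
  | lbl (l : L)
  /-- `LIO^TCB t` -/
  | lio (t : Term L)
  /-- `Lb^TCB l t` -/
  | lb (l : L) (t : Term L)
  /-- `Ref_FI^TCB l a` -/
  | refFI (l : L) (a : Addr)
  /-- `Ref_FS^TCB a` -/
  | refFS (a : Addr)
  | var (n : ℕ)
  | app (t u : Term L)
  | fix (t : Term L)
  | ite (c t u : Term L)
  | op (o : LabelOp) (t u : Term L)
  | ret (t : Term L)
  | bind (t u : Term L)
  | getLabel
  | label (l t : Term L)
  | unlabel (t : Term L)
  | labelOf (t : Term L)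
  | toLabeled (l t : Term L)
  | newRef (s : RefKind) (l t : Term L)
  | writeRef (s : RefKind) (r t : Term L)
  | readRef (s : RefKind) (r : Term L)
  | labelOfRef (s : RefKind) (r : Term L)
  | copyRef (r r' : Term L)
  | upgrade (r l : Term L)
  | downgrade (r l : Term L)
  /-- `⇑`, the divergent term: it has every type and no reduction rule. -/
  | div
  /-- `•`, the mark left by erasure: it has no type and no reduction rule, hence does not occur
  in well-typed programs. -/
  | hole

namespace Term

variable {L : Type*}

/-- The values. -/
inductive IsValue : Term L → Prop
  | bool (b : Bool) : IsValue (.bool b)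
  | unit : IsValue .unit
  | lam (t : Term L) : IsValue (.lam t)
  | lbl (l : L) : IsValue (.lbl l)
  | lio (t : Term L) : IsValue (.lio t)
  | lb (l : L) (t : Term L) : IsValue (.lb l t)
  | refFI (l : L) (a : Addr) : IsValue (.refFI l a)
  | refFS (a : Addr) : IsValue (.refFS a)

/-- Increment the free variables with index at least `c`. -/
def shift : ℕ → Term L → Term L
  | _, .bool b => .bool b
  | _, .unit => .unit
  | c, .lam t => .lam (shift (c + 1) t)
  | _, .lbl l => .lbl l
  | c, .lio t => .lio (shift c t)
  | c, .lb l t => .lb l (shift c t)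
  | _, .refFI l a => .refFI l a
  | _, .refFS a => .refFS a
  | c, .var n => if n < c then .var n else .var (n + 1)
  | c, .app t u => .app (shift c t) (shift c u)
  | c, .fix t => .fix (shift c t)
  | c, .ite b t u => .ite (shift c b) (shift c t) (shift c u)
  | c, .op o t u => .op o (shift c t) (shift c u)
  | c, .ret t => .ret (shift c t)
  | c, .bind t u => .bind (shift c t) (shift c u)
  | _, .getLabel => .getLabel
  | c, .label l t => .label (shift c l) (shift c t)
  | c, .unlabel t => .unlabel (shift c t)
  | c, .labelOf t => .labelOf (shift c t)
  | c, .toLabeled l t => .toLabeled (shift c l) (shift c t)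
  | c, .newRef s l t => .newRef s (shift c l) (shift c t)
  | c, .writeRef s r t => .writeRef s (shift c r) (shift c t)
  | c, .readRef s r => .readRef s (shift c r)
  | c, .labelOfRef s r => .labelOfRef s (shift c r)
  | c, .copyRef r r' => .copyRef (shift c r) (shift c r')
  | c, .upgrade r l => .upgrade (shift c r) (shift c l)
  | c, .downgrade r l => .downgrade (shift c r) (shift c l)
  | _, .div => .div
  | _, .hole => .hole

/-- `subst k u t` replaces variable `k` of `t` by `u` and decrements the variables above `k`;
`subst 0 u t` is the capture-avoiding `{u/x} t` for the body `t` of `λx.t`. -/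
def subst : ℕ → Term L → Term L → Term L
  | _, _, .bool b => .bool b
  | _, _, .unit => .unit
  | k, u, .lam t => .lam (subst (k + 1) (shift 0 u) t)
  | _, _, .lbl l => .lbl l
  | k, u, .lio t => .lio (subst k u t)
  | k, u, .lb l t => .lb l (subst k u t)
  | _, _, .refFI l a => .refFI l a
  | _, _, .refFS a => .refFS a
  | k, u, .var n => if n < k then .var n else if n = k then u else .var (n - 1)
  | k, u, .app t t' => .app (subst k u t) (subst k u t')
  | k, u, .fix t => .fix (subst k u t)
  | k, u, .ite b t t' => .ite (subst k u b) (subst k u t) (subst k u t')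
  | k, u, .op o t t' => .op o (subst k u t) (subst k u t')
  | k, u, .ret t => .ret (subst k u t)
  | k, u, .bind t t' => .bind (subst k u t) (subst k u t')
  | _, _, .getLabel => .getLabel
  | k, u, .label l t => .label (subst k u l) (subst k u t)
  | k, u, .unlabel t => .unlabel (subst k u t)
  | k, u, .labelOf t => .labelOf (subst k u t)
  | k, u, .toLabeled l t => .toLabeled (subst k u l) (subst k u t)
  | k, u, .newRef s l t => .newRef s (subst k u l) (subst k u t)
  | k, u, .writeRef s r t => .writeRef s (subst k u r) (subst k u t)
  | k, u, .readRef s r => .readRef s (subst k u r)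
  | k, u, .labelOfRef s r => .labelOfRef s (subst k u r)
  | k, u, .copyRef r r' => .copyRef (subst k u r) (subst k u r')
  | k, u, .upgrade r l => .upgrade (subst k u r) (subst k u l)
  | k, u, .downgrade r l => .downgrade (subst k u r) (subst k u l)
  | _, _, .div => .div
  | _, _, .hole => .hole

/-- Renaming of addresses. -/
def rename (f : Addr → Addr) : Term L → Term L
  | .bool b => .bool b
  | .unit => .unit
  | .lam t => .lam (rename f t)
  | .lbl l => .lbl l
  | .lio t => .lio (rename f t)
  | .lb l t => .lb l (rename f t)
  | .refFI l a => .refFI l (f a)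
  | .refFS a => .refFS (f a)
  | .var n => .var n
  | .app t u => .app (rename f t) (rename f u)
  | .fix t => .fix (rename f t)
  | .ite b t u => .ite (rename f b) (rename f t) (rename f u)
  | .op o t u => .op o (rename f t) (rename f u)
  | .ret t => .ret (rename f t)
  | .bind t u => .bind (rename f t) (rename f u)
  | .getLabel => .getLabel
  | .label l t => .label (rename f l) (rename f t)
  | .unlabel t => .unlabel (rename f t)
  | .labelOf t => .labelOf (rename f t)
  | .toLabeled l t => .toLabeled (rename f l) (rename f t)
  | .newRef s l t => .newRef s (rename f l) (rename f t)
  | .writeRef s r t => .writeRef s (rename f r) (rename f t)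
  | .readRef s r => .readRef s (rename f r)
  | .labelOfRef s r => .labelOfRef s (rename f r)
  | .copyRef r r' => .copyRef (rename f r) (rename f r')
  | .upgrade r l => .upgrade (rename f r) (rename f l)
  | .downgrade r l => .downgrade (rename f r) (rename f l)
  | .div => .div
  | .hole => .hole

/-- The term contains no reference node `Ref_FI^TCB`, `Ref_FS^TCB`. Every term without TCB nodes
satisfies this; beyond those, labeled values `Lb^TCB l t` and `LIO^TCB t` are admitted, so that
programs may carry labeled inputs. -/
def RefFree : Term L → Prop
  | .refFI _ _ | .refFS _ => False
  | .bool _ | .unit | .lbl _ | .var _ | .getLabel | .div | .hole => True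
  | .lam t | .lio t | .lb _ t | .fix t | .ret t | .unlabel t | .labelOf t
  | .readRef _ t | .labelOfRef _ t => RefFree t
  | .app t u | .op _ t u | .bind t u | .label t u | .toLabeled t u | .newRef _ t u
  | .writeRef _ t u | .copyRef t u | .upgrade t u | .downgrade t u => RefFree t ∧ RefFree u
  | .ite b t u => RefFree b ∧ RefFree t ∧ RefFree u

open Classical in
/-- Erasure of all information that is not observable at level `A`: the content of a labeled
value whose label does not flow to `A` is replaced by `•`; homomorphic on all other nodes. -/
noncomputable def erase [LE L] (A : L) : Term L → Term L
  | .bool b => .bool b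
  | .unit => .unit
  | .lam t => .lam (erase A t)
  | .lbl l => .lbl l
  | .lio t => .lio (erase A t)
  | .lb l t => if l ≤ A then .lb l (erase A t) else .lb l .hole
  | .refFI l a => .refFI l a
  | .refFS a => .refFS a
  | .var n => .var n
  | .app t u => .app (erase A t) (erase A u)
  | .fix t => .fix (erase A t)
  | .ite b t u => .ite (erase A b) (erase A t) (erase A u)
  | .op o t u => .op o (erase A t) (erase A u)
  | .ret t => .ret (erase A t)
  | .bind t u => .bind (erase A t) (erase A u)
  | .getLabel => .getLabel
  | .label l t => .label (erase A l) (erase A t)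
  | .unlabel t => .unlabel (erase A t)
  | .labelOf t => .labelOf (erase A t)
  | .toLabeled l t => .toLabeled (erase A l) (erase A t)
  | .newRef s l t => .newRef s (erase A l) (erase A t)
  | .writeRef s r t => .writeRef s (erase A r) (erase A t)
  | .readRef s r => .readRef s (erase A r)
  | .labelOfRef s r => .labelOfRef s (erase A r)
  | .copyRef r r' => .copyRef (erase A r) (erase A r')
  | .upgrade r l => .upgrade (erase A r) (erase A l)
  | .downgrade r l => .downgrade (erase A r) (erase A l)
  | .div => .div
  | .hole => .hole

/-- `t ≈_A u`: the terms are syntactically equal after erasure. -/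
def LowEquiv [LE L] (A : L) (t u : Term L) : Prop := t.erase A = u.erase A

end Term

/-- A state `Σ = (l_cur, μ_FI, μ_FS)`. In `fi`, the pair `(l, t)` stands for `Lb l t`;
in `fs`, the triple `(lo, ld, t)` stands for `Lb lo (Lb ld t)`. -/
structure State (L : Type*) where
  cur : L
  fi : Addr → Option (L × Term L)
  fs : Addr → Option (L × L × Term L)

/-- A configuration `⟨Σ | t⟩`. -/
structure Conf (L : Type*) where
  state : State L
  term : Term L

/-- The address is in the domain of one of the two stores. -/
def State.Allocated {L : Type*} (S : State L) (a : Addr) : Prop :=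
  S.fi a ≠ none ∨ S.fs a ≠ none

/-! ### Typing -/

/-- A store typing `Δ`: the type of the content of each allocated reference. -/
abbrev StoreTyping : Type := RefKind → Addr → Option Ty

/-- `Δ, Γ ⊢ t : τ`; position `n` of the list `Γ` is the type of variable `n`. -/
inductive HasType {L : Type*} (Δ : StoreTyping) : List Ty → Term L → Ty → Prop
  | bool {Γ} (b : Bool) : HasType Δ Γ (.bool b) .bool
  | unit {Γ} : HasType Δ Γ .unit .unit
  | lam {Γ t τ σ} : HasType Δ (τ :: Γ) t σ → HasType Δ Γ (.lam t) (.arrow τ σ)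
  | lbl {Γ} (l : L) : HasType Δ Γ (.lbl l) .label
  | lio {Γ t τ} : HasType Δ Γ t τ → HasType Δ Γ (.lio t) (.lio τ)
  | lb {Γ t τ} (l : L) : HasType Δ Γ t τ → HasType Δ Γ (.lb l t) (.labeled τ)
  | refFI {Γ a τ} (l : L) : Δ .fi a = some τ → HasType Δ Γ (.refFI l a) (.ref .fi τ)
  | refFS {Γ a τ} : Δ .fs a = some τ → HasType Δ Γ (.refFS a) (.ref .fs τ)
  | var {Γ n τ} : Γ[n]? = some τ → HasType Δ Γ (.var n) τ
  | app {Γ t u τ σ} : HasType Δ Γ t (.arrow τ σ) → HasType Δ Γ u τ → HasType Δ Γ (.app t u) σ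
  | fix {Γ t τ} : HasType Δ Γ t (.arrow τ τ) → HasType Δ Γ (.fix t) τ
  | ite {Γ b t u τ} : HasType Δ Γ b .bool → HasType Δ Γ t τ → HasType Δ Γ u τ →
      HasType Δ Γ (.ite b t u) τ
  | op {Γ t u} (o : LabelOp) : HasType Δ Γ t .label → HasType Δ Γ u .label →
      HasType Δ Γ (.op o t u) o.resultTy
  | ret {Γ t τ} : HasType Δ Γ t τ → HasType Δ Γ (.ret t) (.lio τ)
  | bind {Γ t u τ σ} : HasType Δ Γ t (.lio τ) → HasType Δ Γ u (.arrow τ (.lio σ)) →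
      HasType Δ Γ (.bind t u) (.lio σ)
  | getLabel {Γ} : HasType Δ Γ .getLabel (.lio .label)
  | label {Γ l t τ} : HasType Δ Γ l .label → HasType Δ Γ t τ →
      HasType Δ Γ (.label l t) (.lio (.labeled τ))
  | unlabel {Γ t τ} : HasType Δ Γ t (.labeled τ) → HasType Δ Γ (.unlabel t) (.lio τ)
  | labelOf {Γ t τ} : HasType Δ Γ t (.labeled τ) → HasType Δ Γ (.labelOf t) .label
  | toLabeled {Γ l t τ} : HasType Δ Γ l .label → HasType Δ Γ t (.lio τ) →
      HasType Δ Γ (.toLabeled l t) (.lio (.labeled τ))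
  | newRef {Γ l t τ} (s : RefKind) : HasType Δ Γ l .label → HasType Δ Γ t τ →
      HasType Δ Γ (.newRef s l t) (.lio (.ref s τ))
  | writeRef {Γ r t τ} (s : RefKind) : HasType Δ Γ r (.ref s τ) → HasType Δ Γ t τ →
      HasType Δ Γ (.writeRef s r t) (.lio .unit)
  | readRef {Γ r τ} (s : RefKind) : HasType Δ Γ r (.ref s τ) →
      HasType Δ Γ (.readRef s r) (.lio τ)
  | labelOfFI {Γ r τ} : HasType Δ Γ r (.ref .fi τ) → HasType Δ Γ (.labelOfRef .fi r) .label
  | labelOfFS {Γ r τ} : HasType Δ Γ r (.ref .fs τ) →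
      HasType Δ Γ (.labelOfRef .fs r) (.lio .label)
  | copyRef {Γ r r' τ} : HasType Δ Γ r (.ref .fi τ) → HasType Δ Γ r' (.ref .fi τ) →
      HasType Δ Γ (.copyRef r r') (.lio .unit)
  | upgrade {Γ r l τ} : HasType Δ Γ r (.ref .fs τ) → HasType Δ Γ l .label →
      HasType Δ Γ (.upgrade r l) (.lio .unit)
  | downgrade {Γ r l τ} : HasType Δ Γ r (.ref .fs τ) → HasType Δ Γ l .label →
      HasType Δ Γ (.downgrade r l) (.lio .unit)
  | div {Γ} (τ : Ty) : HasType Δ Γ .div τ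

/-- `Δ` types the stores of `S`: it has the same domains, and each stored term has the type that
`Δ` assigns to its address. -/
structure State.WellTyped {L : Type*} (Δ : StoreTyping) (Γ : List Ty) (S : State L) : Prop where
  fi_dom : ∀ a, Δ .fi a = none ↔ S.fi a = none
  fs_dom : ∀ a, Δ .fs a = none ↔ S.fs a = none
  fi_type : ∀ a l t τ, S.fi a = some (l, t) → Δ .fi a = some τ → HasType Δ Γ t τ
  fs_type : ∀ a lo ld t τ, S.fs a = some (lo, ld, t) → Δ .fs a = some τ → HasType Δ Γ t τ

/-! ### Operational semantics -/

/-- Reduction of pure terms: the redexes, and closure under the pure evaluation contexts. -/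
inductive PureStep {L : Type*} [Lattice L] : Term L → Term L → Prop
  | beta (t u : Term L) : PureStep (.app (.lam t) u) (Term.subst 0 u t)
  | fix (t : Term L) : PureStep (.fix (.lam t)) (Term.subst 0 (.fix (.lam t)) t)
  | ifTrue (t u : Term L) : PureStep (.ite (.bool true) t u) t
  | ifFalse (t u : Term L) : PureStep (.ite (.bool false) t u) u
  | join (l l' : L) : PureStep (.op .join (.lbl l) (.lbl l')) (.lbl (l ⊔ l'))
  | meet (l l' : L) : PureStep (.op .meet (.lbl l) (.lbl l')) (.lbl (l ⊓ l'))
  | flowsTrue (l l' : L) : l ≤ l' → PureStep (.op .flows (.lbl l) (.lbl l')) (.bool true)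
  | flowsFalse (l l' : L) : ¬ l ≤ l' → PureStep (.op .flows (.lbl l) (.lbl l')) (.bool false)
  | labelOf (l : L) (t : Term L) : PureStep (.labelOf (.lb l t)) (.lbl l)
  | labelOfFI (l : L) (a : Addr) : PureStep (.labelOfRef .fi (.refFI l a)) (.lbl l)
  | appCtx {t t'} (u : Term L) : PureStep t t' → PureStep (.app t u) (.app t' u)
  | fixCtx {t t' : Term L} : PureStep t t' → PureStep (.fix t) (.fix t')
  | iteCtx {b b'} (t u : Term L) : PureStep b b' → PureStep (.ite b t u) (.ite b' t u)
  | opCtxL {t t'} (o : LabelOp) (u : Term L) : PureStep t t' → PureStep (.op o t u) (.op o t' u)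
  | opCtxR {v u u' : Term L} (o : LabelOp) : v.IsValue → PureStep u u' →
      PureStep (.op o v u) (.op o v u')
  | labelCtx {l l'} (t : Term L) : PureStep l l' → PureStep (.label l t) (.label l' t)
  | unlabelCtx {t t' : Term L} : PureStep t t' → PureStep (.unlabel t) (.unlabel t')
  | labelOfCtx {t t' : Term L} : PureStep t t' → PureStep (.labelOf t) (.labelOf t')
  | toLabeledCtx {l l'} (t : Term L) : PureStep l l' →
      PureStep (.toLabeled l t) (.toLabeled l' t)
  | newRefCtx {l l'} (s : RefKind) (t : Term L) : PureStep l l' →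
      PureStep (.newRef s l t) (.newRef s l' t)
  | writeRefCtx {r r'} (s : RefKind) (t : Term L) : PureStep r r' →
      PureStep (.writeRef s r t) (.writeRef s r' t)
  | readRefCtx {r r' : Term L} (s : RefKind) : PureStep r r' →
      PureStep (.readRef s r) (.readRef s r')
  | labelOfRefCtx {r r' : Term L} (s : RefKind) : PureStep r r' →
      PureStep (.labelOfRef s r) (.labelOfRef s r')
  | copyRefCtxL {r r'} (u : Term L) : PureStep r r' → PureStep (.copyRef r u) (.copyRef r' u)
  | copyRefCtxR {v u u' : Term L} : v.IsValue → PureStep u u' →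
      PureStep (.copyRef v u) (.copyRef v u')
  | upgradeCtxL {r r'} (u : Term L) : PureStep r r' → PureStep (.upgrade r u) (.upgrade r' u)
  | upgradeCtxR {v u u' : Term L} : v.IsValue → PureStep u u' →
      PureStep (.upgrade v u) (.upgrade v u')
  | downgradeCtxL {r r'} (u : Term L) : PureStep r r' →
      PureStep (.downgrade r u) (.downgrade r' u)
  | downgradeCtxR {v u u' : Term L} : v.IsValue → PureStep u u' →
      PureStep (.downgrade v u) (.downgrade v u')

mutual

/-- One step `⟨Σ | t⟩ ⟶ ⟨Σ' | t'⟩`. The monadic evaluation contexts are nested left-hand sides of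
binds (rule `bindCtx`) around a pure step or a monadic redex; no position of a pure evaluation
context has a type `LIO τ`, so in a well-typed term no monadic redex sits below one. -/
inductive Step {L : Type u} [Lattice L] : Conf L → Conf L → Prop
  | pure (S : State L) {t t'} : PureStep t t' → Step ⟨S, t⟩ ⟨S, t'⟩
  | bindCtx {S S' t t'} (u : Term L) : Step ⟨S, t⟩ ⟨S', t'⟩ →
      Step ⟨S, .bind t u⟩ ⟨S', .bind t' u⟩
  | ret (S : State L) (t : Term L) : Step ⟨S, .ret t⟩ ⟨S, .lio t⟩
  | bind (S : State L) (t u : Term L) : Step ⟨S, .bind (.lio t) u⟩ ⟨S, .app u t⟩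
  | getLabel (S : State L) : Step ⟨S, .getLabel⟩ ⟨S, .ret (.lbl S.cur)⟩
  | label (S : State L) (l : L) (t : Term L) : S.cur ≤ l →
      Step ⟨S, .label (.lbl l) t⟩ ⟨S, .ret (.lb l t)⟩
  | unlabel (S : State L) (l : L) (t : Term L) :
      Step ⟨S, .unlabel (.lb l t)⟩ ⟨{ S with cur := S.cur ⊔ l }, .ret t⟩
  | toLabeled (S S' : State L) (l : L) (t t' : Term L) : S.cur ≤ l →
      Steps ⟨S, t⟩ ⟨S', .lio t'⟩ → S'.cur ≤ l →
      Step ⟨S, .toLabeled (.lbl l) t⟩ ⟨{ S' with cur := S.cur }, .label (.lbl l) t'⟩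
  | newRefFI (S : State L) (l : L) (t : Term L) (a : Addr) : S.cur ≤ l → ¬ S.Allocated a →
      Step ⟨S, .newRef .fi (.lbl l) t⟩
        ⟨{ S with fi := Function.update S.fi a (some (l, t)) }, .ret (.refFI l a)⟩
  | readRefFI (S : State L) (l : L) (a : Addr) (l' : L) (t : Term L) :
      S.fi a = some (l', t) →
      Step ⟨S, .readRef .fi (.refFI l a)⟩ ⟨S, .unlabel (.lb l' t)⟩
  | writeRefFI (S : State L) (l : L) (a : Addr) (t : Term L) : S.cur ≤ l →
      Step ⟨S, .writeRef .fi (.refFI l a) t⟩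
        ⟨{ S with fi := Function.update S.fi a (some (l, t)) }, .ret .unit⟩
  | copyRef (S : State L) (l₁ : L) (a₁ : Addr) (l₂ : L) (a₂ : Addr) (t : Term L) :
      l₁ ≤ l₂ → S.cur ≤ l₂ → S.fi a₁ = some (l₁, t) →
      Step ⟨S, .copyRef (.refFI l₁ a₁) (.refFI l₂ a₂)⟩
        ⟨{ S with fi := Function.update S.fi a₂ (some (l₂, t)) }, .ret .unit⟩
  | newRefFS (S : State L) (l : L) (t : Term L) (a : Addr) : S.cur ≤ l → ¬ S.Allocated a →
      Step ⟨S, .newRef .fs (.lbl l) t⟩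
        ⟨{ S with fs := Function.update S.fs a (some (S.cur, l, t)) }, .ret (.refFS a)⟩
  | readRefFS (S : State L) (a : Addr) (lo ld : L) (t : Term L) : S.fs a = some (lo, ld, t) →
      Step ⟨S, .readRef .fs (.refFS a)⟩ ⟨S, .unlabel (.lb (lo ⊔ ld) t)⟩
  | writeRefFS (S : State L) (a : Addr) (lo ld : L) (t t' : Term L) :
      S.fs a = some (lo, ld, t') → S.cur ≤ lo ⊔ ld →
      Step ⟨S, .writeRef .fs (.refFS a) t⟩
        ⟨{ S with fs := Function.update S.fs a (some (lo, ld, t)) }, .ret .unit⟩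
  | writeRefFSFail (S : State L) (a : Addr) (lo ld : L) (t t' : Term L) :
      S.fs a = some (lo, ld, t') → ¬ S.cur ≤ lo ⊔ ld →
      Step ⟨S, .writeRef .fs (.refFS a) t⟩ ⟨S, .unlabel (.lb lo .div)⟩
  | labelOfFS (S : State L) (a : Addr) (lo ld : L) (t : Term L) : S.fs a = some (lo, ld, t) →
      Step ⟨S, .labelOfRef .fs (.refFS a)⟩ ⟨S, .unlabel (.lb lo (.lbl ld))⟩
  | upgrade (S : State L) (a : Addr) (lo ld l : L) (t : Term L) :
      S.fs a = some (lo, ld, t) → S.cur ≤ lo →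
      Step ⟨S, .upgrade (.refFS a) (.lbl l)⟩
        ⟨{ S with fs := Function.update S.fs a (some (lo, ld ⊔ l, t)) }, .ret .unit⟩
  | downgrade (S : State L) (a : Addr) (lo ld l : L) (t : Term L) :
      S.fs a = some (lo, ld, t) → S.cur ≤ lo →
      Step ⟨S, .downgrade (.refFS a) (.lbl l)⟩
        ⟨{ S with fs := Function.update S.fs a (some (lo, lo ⊔ (ld ⊓ l), .div)) }, .ret .unit⟩

/-- `⟶*`, the reflexive transitive closure of `Step`. -/
inductive Steps {L : Type u} [Lattice L] : Conf L → Conf L → Prop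
  | refl (C : Conf L) : Steps C C
  | head {C C' C'' : Conf L} : Step C C' → Steps C' C'' → Steps C C''

end

/-! ### Low equivalence of configurations -/

section LowEquivalence

variable {L : Type*}

/-- Renaming of the addresses of a configuration: in the domains of the stores, in the stored
terms and in the term under evaluation. -/
def Conf.rename (π : Equiv.Perm Addr) (C : Conf L) : Conf L where
  state :=
    { cur := C.state.cur
      fi := fun a => (C.state.fi (π.symm a)).map fun c => (c.1, c.2.rename π)
      fs := fun a => (C.state.fs (π.symm a)).map fun c => (c.1, c.2.1, c.2.2.rename π) }
  term := C.term.rename π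

/-- What is left of a configuration after erasure; `cur` holds the current label together with
the term under evaluation, or `none` if both are erased. -/
structure ErasedConf (L : Type*) where
  cur : Option (L × Term L)
  fi : Addr → Option (L × Term L)
  fs : Addr → Option (L × L × Term L)

open Classical in
/-- Erasure of a configuration at observation level `A`. The current label protects itself and
the term under evaluation. A binding `a ↦ Lb l t` of the flow-insensitive store is kept if
`l ⊑ A`, with erased content. A binding `a ↦ Lb lo (Lb ld t)` of the flow-sensitive store is
kept if `lo ⊑ A`, and its content is the erasure of `Lb ld t`. -/
noncomputable def Conf.erase [LE L] (A : L) (C : Conf L) : ErasedConf L where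
  cur := if C.state.cur ≤ A then some (C.state.cur, C.term.erase A) else none
  fi := fun a => (C.state.fi a).bind fun c =>
    if c.1 ≤ A then some (c.1, c.2.erase A) else none
  fs := fun a => (C.state.fs a).bind fun c =>
    if c.1 ≤ A then some (c.1, c.2.1, if c.2.1 ≤ A then c.2.2.erase A else .hole) else none

/-- `C ≈_A C'`, relative to a set `D` of addresses known in advance: after erasure the two
configurations are syntactically equal up to a renaming of addresses that fixes `D`. (The names
of freshly allocated addresses are arbitrary.) -/
def Conf.LowEquiv [LE L] (A : L) (D : Set Addr) (C C' : Conf L) : Prop :=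
  ∃ π : Equiv.Perm Addr, (∀ a ∈ D, π a = a) ∧ (C.rename π).erase A = C'.erase A

end LowEquivalence

end FloatingLabel

namespace FloatingLabel

namespace Term

variable {L : Type*}

/-- All flow-insensitive reference nodes satisfy `P` and all flow-sensitive ones satisfy `Q`. -/
def AllRefs (P : L → Addr → Prop) (Q : Addr → Prop) : Term L → Prop
  | .refFI l a => P l a
  | .refFS a => Q a
  | .bool _ | .unit | .lbl _ | .var _ | .getLabel | .div | .hole => True
  | .lam t | .lio t | .lb _ t | .fix t | .ret t | .unlabel t | .labelOf t
  | .readRef _ t | .labelOfRef _ t => AllRefs P Q t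
  | .app t u | .op _ t u | .bind t u | .label t u | .toLabeled t u | .newRef _ t u
  | .writeRef _ t u | .copyRef t u | .upgrade t u | .downgrade t u =>
      AllRefs P Q t ∧ AllRefs P Q u
  | .ite b t u => AllRefs P Q b ∧ AllRefs P Q t ∧ AllRefs P Q u

theorem AllRefs.mono {P P' : L → Addr → Prop} {Q Q' : Addr → Prop}
    (hP : ∀ l a, P l a → P' l a) (hQ : ∀ a, Q a → Q' a) {t : Term L} :
    t.AllRefs P Q → t.AllRefs P' Q' := by
  induction t <;> simp only [AllRefs] <;> grind

theorem RefFree.allRefs {P : L → Addr → Prop} {Q : Addr → Prop} {t : Term L} :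
    t.RefFree → t.AllRefs P Q := by
  induction t <;> simp only [AllRefs, RefFree] <;> grind

theorem AllRefs.and {P P' : L → Addr → Prop} {Q Q' : Addr → Prop} {t : Term L} :
    t.AllRefs P Q → t.AllRefs P' Q' →
      t.AllRefs (fun l a => P l a ∧ P' l a) (fun a => Q a ∧ Q' a) := by
  induction t <;> simp only [AllRefs] <;> grind

theorem AllRefs.shift {P : L → Addr → Prop} {Q : Addr → Prop} {t : Term L}
    (h : t.AllRefs P Q) (c : ℕ) : (t.shift c).AllRefs P Q := by
  induction t generalizing c <;> simp only [AllRefs, Term.shift] at h ⊢ <;>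
    first | (split <;> simp [AllRefs]) | grind

theorem AllRefs.subst {P : L → Addr → Prop} {Q : Addr → Prop} {t : Term L}
    (h : t.AllRefs P Q) (k : ℕ) {u : Term L} (hu : u.AllRefs P Q) :
    (Term.subst k u t).AllRefs P Q := by
  induction t generalizing k u <;> simp only [AllRefs, Term.subst] at h ⊢ <;>
    first
    | (split_ifs <;> first | exact hu | simp [AllRefs])
    | grind [AllRefs.shift]

theorem AllRefs.erase [LE L] {P : L → Addr → Prop} {Q : Addr → Prop} {t : Term L}
    (h : t.AllRefs P Q) (A : L) : (t.erase A).AllRefs P Q := by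
  induction t <;> simp only [AllRefs, Term.erase] at h ⊢ <;>
    first | (split_ifs <;> simp_all [AllRefs]) | grind

theorem allRefs_rename {P : L → Addr → Prop} {Q : Addr → Prop} (f : Addr → Addr) (t : Term L) :
    (t.rename f).AllRefs P Q ↔ t.AllRefs (fun l a => P l (f a)) (fun a => Q (f a)) := by
  induction t <;> simp_all [AllRefs, Term.rename]

theorem AllRefs.rename_congr {f g : Addr → Addr} {t : Term L}
    (h : t.AllRefs (fun _ a => f a = g a) (fun a => f a = g a)) : t.rename f = t.rename g := by
  induction t <;> simp_all [AllRefs, Term.rename]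

theorem rename_id (t : Term L) : t.rename id = t := by
  induction t <;> simp_all [Term.rename]

theorem erase_shift [LE L] (A : L) (t : Term L) (c : ℕ) :
    (t.shift c).erase A = (t.erase A).shift c := by
  induction t generalizing c <;> simp only [Term.shift, Term.erase] <;>
    first | (split_ifs <;> simp_all [Term.shift, Term.erase]) | grind

theorem erase_subst [LE L] (A : L) (t u : Term L) (k : ℕ) :
    (subst k u t).erase A = subst k (u.erase A) (t.erase A) := by
  induction t generalizing k u <;> simp only [Term.subst, Term.erase] <;>
    first | (split_ifs <;> simp_all [Term.subst, Term.erase]) | grind [erase_shift]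

theorem erase_rename [LE L] (A : L) (f : Addr → Addr) (t : Term L) :
    (t.rename f).erase A = (t.erase A).rename f := by
  induction t <;> simp only [Term.rename, Term.erase] <;>
    first | (split_ifs <;> simp_all [Term.rename]) | grind

theorem rename_shift (f : Addr → Addr) (t : Term L) (c : ℕ) :
    (t.shift c).rename f = (t.rename f).shift c := by
  induction t generalizing c <;> simp only [Term.shift, Term.rename] <;>
    first | (split_ifs <;> simp_all [Term.rename]) | grind

theorem rename_subst (f : Addr → Addr) (t u : Term L) (k : ℕ) :
    (subst k u t).rename f = subst k (u.rename f) (t.rename f) := by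
  induction t generalizing k u <;> simp only [Term.subst, Term.rename] <;>
    first | (split_ifs <;> simp_all [Term.rename]) | grind [rename_shift]

theorem isValue_erase [LE L] (A : L) (t : Term L) : (t.erase A).IsValue ↔ t.IsValue := by
  cases t <;> simp only [Term.erase] <;> (try split_ifs) <;> constructor <;> intro h <;>
    first | constructor | cases h

theorem isValue_rename (f : Addr → Addr) (t : Term L) : (t.rename f).IsValue ↔ t.IsValue := by
  cases t <;> simp only [Term.rename] <;> constructor <;> intro h <;>
    first | constructor | cases h

end Term

section PureReduction

variable {L : Type*} [Lattice L]

theorem PureStep.not_isValue {t t' : Term L} (h : PureStep t t') : ¬ t.IsValue := by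
  intro hv; cases hv <;> cases h

theorem PureStep.allRefs {P : L → Addr → Prop} {Q : Addr → Prop} {t t' : Term L}
    (h : PureStep t t') : t.AllRefs P Q → t'.AllRefs P Q := by
  induction h <;> intro H <;> simp only [Term.AllRefs] at H ⊢ <;>
    grind [Term.AllRefs.subst, Term.AllRefs]

theorem PureStep.rename (f : Addr → Addr) {t t' : Term L} (h : PureStep t t') :
    PureStep (t.rename f) (t'.rename f) := by
  induction h <;> simp only [Term.rename, Term.rename_subst] <;>
    first
    | (constructor <;> first | assumption | (rw [Term.isValue_rename]; assumption))

theorem PureStep.erase (A : L) {t t' : Term L} (h : PureStep t t') :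
    PureStep (t.erase A) (t'.erase A) := by
  induction h <;> simp only [Term.erase, Term.erase_subst] <;> (try split_ifs) <;>
    first
    | (constructor <;> first | assumption | (rw [Term.isValue_erase]; assumption))

theorem PureStep.deterministic {t t' t'' : Term L} (h : PureStep t t') (h' : PureStep t t'') :
    t' = t'' := by
  induction h generalizing t'' <;> cases h' <;>
    first
    | rfl
    | (exfalso; first
        | contradiction
        | exact PureStep.not_isValue ‹_› ‹_›
        | (rename_i h _ _ hv _; exact PureStep.not_isValue h hv))
    | (congr 1; rename_i ih _ h; exact ih h)
    | (congr 1; rename_i ih _ _ h; exact ih h)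

end PureReduction

section BigStep

variable {L : Type*} [Lattice L]

/-- `Action S t S' r`: the monadic redex `t`, other than a bind or a `toLabeled`, evaluates in the
state `S` to `LIO r` and leaves the state `S'`. -/
inductive Action : State L → Term L → State L → Term L → Prop
  | ret (S : State L) (t : Term L) : Action S (.ret t) S t
  | getLabel (S : State L) : Action S .getLabel S (.lbl S.cur)
  | label (S : State L) (l : L) (t : Term L) : S.cur ≤ l →
      Action S (.label (.lbl l) t) S (.lb l t)
  | unlabel (S : State L) (l : L) (t : Term L) :
      Action S (.unlabel (.lb l t)) { S with cur := S.cur ⊔ l } t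
  | newRefFI (S : State L) (l : L) (t : Term L) (a : Addr) : S.cur ≤ l → ¬ S.Allocated a →
      Action S (.newRef .fi (.lbl l) t)
        { S with fi := Function.update S.fi a (some (l, t)) } (.refFI l a)
  | readRefFI (S : State L) (l : L) (a : Addr) (l' : L) (t : Term L) :
      S.fi a = some (l', t) →
      Action S (.readRef .fi (.refFI l a)) { S with cur := S.cur ⊔ l' } t
  | writeRefFI (S : State L) (l : L) (a : Addr) (t : Term L) : S.cur ≤ l →
      Action S (.writeRef .fi (.refFI l a) t)
        { S with fi := Function.update S.fi a (some (l, t)) } .unit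
  | copyRef (S : State L) (l₁ : L) (a₁ : Addr) (l₂ : L) (a₂ : Addr) (t : Term L) :
      l₁ ≤ l₂ → S.cur ≤ l₂ → S.fi a₁ = some (l₁, t) →
      Action S (.copyRef (.refFI l₁ a₁) (.refFI l₂ a₂))
        { S with fi := Function.update S.fi a₂ (some (l₂, t)) } .unit
  | newRefFS (S : State L) (l : L) (t : Term L) (a : Addr) : S.cur ≤ l → ¬ S.Allocated a →
      Action S (.newRef .fs (.lbl l) t)
        { S with fs := Function.update S.fs a (some (S.cur, l, t)) } (.refFS a)
  | readRefFS (S : State L) (a : Addr) (lo ld : L) (t : Term L) : S.fs a = some (lo, ld, t) →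
      Action S (.readRef .fs (.refFS a)) { S with cur := S.cur ⊔ (lo ⊔ ld) } t
  | writeRefFS (S : State L) (a : Addr) (lo ld : L) (t t' : Term L) :
      S.fs a = some (lo, ld, t') → S.cur ≤ lo ⊔ ld →
      Action S (.writeRef .fs (.refFS a) t)
        { S with fs := Function.update S.fs a (some (lo, ld, t)) } .unit
  | writeRefFSFail (S : State L) (a : Addr) (lo ld : L) (t t' : Term L) :
      S.fs a = some (lo, ld, t') → ¬ S.cur ≤ lo ⊔ ld →
      Action S (.writeRef .fs (.refFS a) t) { S with cur := S.cur ⊔ lo } .div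
  | labelOfFS (S : State L) (a : Addr) (lo ld : L) (t : Term L) : S.fs a = some (lo, ld, t) →
      Action S (.labelOfRef .fs (.refFS a)) { S with cur := S.cur ⊔ lo } (.lbl ld)
  | upgrade (S : State L) (a : Addr) (lo ld l : L) (t : Term L) :
      S.fs a = some (lo, ld, t) → S.cur ≤ lo →
      Action S (.upgrade (.refFS a) (.lbl l))
        { S with fs := Function.update S.fs a (some (lo, ld ⊔ l, t)) } .unit
  | downgrade (S : State L) (a : Addr) (lo ld l : L) (t : Term L) :
      S.fs a = some (lo, ld, t) → S.cur ≤ lo →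
      Action S (.downgrade (.refFS a) (.lbl l))
        { S with fs := Function.update S.fs a (some (lo, lo ⊔ (ld ⊓ l), .div)) } .unit

/-- Big-step evaluation to a value. -/
inductive Eval : State L → Term L → State L → Term L → Prop
  | value (S : State L) {v : Term L} : v.IsValue → Eval S v S v
  | pure {S S' : State L} {t t' v : Term L} : PureStep t t' → Eval S t' S' v → Eval S t S' v
  | bind {S S' S'' : State L} {t r u v : Term L} : Eval S t S' (.lio r) →
      Eval S' (.app u r) S'' v → Eval S (.bind t u) S'' v
  | toLabeled {S S' : State L} {l : L} {t r : Term L} : S.cur ≤ l → Eval S t S' (.lio r) →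
      S'.cur ≤ l → Eval S (.toLabeled (.lbl l) t) { S' with cur := S.cur } (.lio (.lb l r))
  | action {S S' : State L} {t r : Term L} : Action S t S' r → Eval S t S' (.lio r)

theorem Action.not_isValue {S S' : State L} {t r : Term L} (h : Action S t S' r) :
    ¬ t.IsValue := by
  intro hv; cases h <;> cases hv

theorem PureStep.not_erased_action {A : L} {f : Addr → Addr} {S S' : State L} {t r s : Term L}
    (h : PureStep ((t.erase A).rename f) s) : ¬ Action S t S' r := by
  intro ha
  cases ha <;> simp only [Term.erase] at h <;> (try split_ifs at h) <;>
    simp only [Term.rename] at h <;> cases h <;>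
    exact PureStep.not_isValue (by assumption) (by constructor)

theorem PureStep.not_action {S S' : State L} {t r s : Term L}
    (h : PureStep t s) : ¬ Action S t S' r := by
  intro ha
  cases ha <;> cases h <;> exact PureStep.not_isValue (by assumption) (by constructor)

theorem Eval.eq_of_isValue {S S' : State L} {t v : Term L} (h : Eval S t S' v)
    (ht : t.IsValue) : S' = S ∧ v = t := by
  cases h with
  | value => exact ⟨rfl, rfl⟩
  | pure hp => exact absurd ht hp.not_isValue
  | bind => cases ht
  | toLabeled => cases ht
  | action ha => exact absurd ht ha.not_isValue

theorem Eval.action_inv {S S₁ S' : State L} {t r v : Term L} (h : Eval S t S' v)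
    (ha : Action S t S₁ r) : ∃ r', v = .lio r' ∧ Action S t S' r' := by
  cases h with
  | value _ hv => exact absurd hv ha.not_isValue
  | pure hp => exact absurd ha hp.not_action
  | bind => cases ha
  | toLabeled => cases ha
  | action h => exact ⟨_, rfl, h⟩

theorem Eval.bind_inv {S S' : State L} {t u v : Term L} (h : Eval S (.bind t u) S' v) :
    ∃ S₁ r, Eval S t S₁ (.lio r) ∧ Eval S₁ (.app u r) S' v := by
  cases h with
  | value _ hv => cases hv
  | pure hp => cases hp
  | bind h h' => exact ⟨_, _, h, h'⟩
  | action ha => cases ha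

theorem Eval.toLabeled_inv {S S' : State L} {l : L} {t v : Term L}
    (h : Eval S (.toLabeled (.lbl l) t) S' v) :
    ∃ S₁ r, S.cur ≤ l ∧ Eval S t S₁ (.lio r) ∧ S₁.cur ≤ l ∧
      S' = { S₁ with cur := S.cur } ∧ v = .lio (.lb l r) := by
  cases h with
  | value _ hv => cases hv
  | pure hp => cases hp with
    | toLabeledCtx _ hp => cases hp
  | toLabeled h h' h'' => exact ⟨_, _, h, h', h'', rfl, rfl⟩
  | action ha => cases ha

theorem Eval.ret_inv {S S' : State L} {t v : Term L} (h : Eval S (.ret t) S' v) :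
    S' = S ∧ v = .lio t := by
  obtain ⟨r, rfl, ha⟩ := h.action_inv (.ret S t)
  cases ha; exact ⟨rfl, rfl⟩

theorem Eval.label_inv {S S' : State L} {l : L} {t v : Term L}
    (h : Eval S (.label (.lbl l) t) S' v) (hl : S.cur ≤ l) : S' = S ∧ v = .lio (.lb l t) := by
  obtain ⟨r, rfl, ha⟩ := h.action_inv (.label S l t hl)
  cases ha; exact ⟨rfl, rfl⟩

theorem Eval.unlabel_inv {S S' : State L} {l : L} {t v : Term L}
    (h : Eval S (.unlabel (.lb l t)) S' v) :
    S' = { S with cur := S.cur ⊔ l } ∧ v = .lio t := by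
  obtain ⟨r, rfl, ha⟩ := h.action_inv (.unlabel S l t)
  cases ha; exact ⟨rfl, rfl⟩

mutual

theorem Step.eval : ∀ {C C' : Conf L}, Step C C' → ∀ {S' : State L} {v : Term L},
    Eval C'.state C'.term S' v → Eval C.state C.term S' v
  | _, _, .pure _ hp, _, _, h => .pure hp h
  | _, _, .bindCtx _ hs, _, _, h => by
      obtain ⟨_, _, h₁, h₂⟩ := Eval.bind_inv h
      exact .bind (hs.eval h₁) h₂
  | _, _, .ret S t, _, _, h => by
      obtain ⟨rfl, rfl⟩ := Eval.eq_of_isValue h (.lio _); exact .action (.ret _ _)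
  | _, _, .bind S _ _, _, _, h => .bind (.value S (.lio _)) h
  | _, _, .getLabel _, _, _, h => by
      obtain ⟨rfl, rfl⟩ := Eval.ret_inv h; exact .action (.getLabel _)
  | _, _, .label _ _ _ hl, _, _, h => by
      obtain ⟨rfl, rfl⟩ := Eval.ret_inv h; exact .action (.label _ _ _ hl)
  | _, _, .unlabel _ _ _, _, _, h => by
      obtain ⟨rfl, rfl⟩ := Eval.ret_inv h; exact .action (.unlabel _ _ _)
  | _, _, .toLabeled _ _ _ _ _ hl hs hl', _, _, h => by
      obtain ⟨rfl, rfl⟩ := Eval.label_inv h hl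
      exact .toLabeled hl (hs.eval (.lio _)) hl'
  | _, _, .newRefFI _ _ _ _ hl ha, _, _, h => by
      obtain ⟨rfl, rfl⟩ := Eval.ret_inv h; exact .action (.newRefFI _ _ _ _ hl ha)
  | _, _, .readRefFI _ _ _ _ _ ha, _, _, h => by
      obtain ⟨rfl, rfl⟩ := Eval.unlabel_inv h; exact .action (.readRefFI _ _ _ _ _ ha)
  | _, _, .writeRefFI _ _ _ _ hl, _, _, h => by
      obtain ⟨rfl, rfl⟩ := Eval.ret_inv h; exact .action (.writeRefFI _ _ _ _ hl)
  | _, _, .copyRef _ _ _ _ _ _ h₁ h₂ ha, _, _, h => by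
      obtain ⟨rfl, rfl⟩ := Eval.ret_inv h; exact .action (.copyRef _ _ _ _ _ _ h₁ h₂ ha)
  | _, _, .newRefFS _ _ _ _ hl ha, _, _, h => by
      obtain ⟨rfl, rfl⟩ := Eval.ret_inv h; exact .action (.newRefFS _ _ _ _ hl ha)
  | _, _, .readRefFS _ _ _ _ _ ha, _, _, h => by
      obtain ⟨rfl, rfl⟩ := Eval.unlabel_inv h; exact .action (.readRefFS _ _ _ _ _ ha)
  | _, _, .writeRefFS _ _ _ _ _ _ ha hl, _, _, h => by
      obtain ⟨rfl, rfl⟩ := Eval.ret_inv h; exact .action (.writeRefFS _ _ _ _ _ _ ha hl)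
  | _, _, .writeRefFSFail _ _ _ _ _ _ ha hl, _, _, h => by
      obtain ⟨rfl, rfl⟩ := Eval.unlabel_inv h
      exact .action (.writeRefFSFail _ _ _ _ _ _ ha hl)
  | _, _, .labelOfFS _ _ _ _ _ ha, _, _, h => by
      obtain ⟨rfl, rfl⟩ := Eval.unlabel_inv h; exact .action (.labelOfFS _ _ _ _ _ ha)
  | _, _, .upgrade _ _ _ _ _ _ ha hl, _, _, h => by
      obtain ⟨rfl, rfl⟩ := Eval.ret_inv h; exact .action (.upgrade _ _ _ _ _ _ ha hl)
  | _, _, .downgrade _ _ _ _ _ _ ha hl, _, _, h => by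
      obtain ⟨rfl, rfl⟩ := Eval.ret_inv h; exact .action (.downgrade _ _ _ _ _ _ ha hl)

theorem Steps.eval : ∀ {C C' : Conf L}, Steps C C' → C'.term.IsValue →
    Eval C.state C.term C'.state C'.term
  | _, _, .refl C, hv => .value C.state hv
  | _, _, .head hs hss, hv => hs.eval (hss.eval hv)

end

end BigStep

section Invariant

variable {L : Type*}

/-- All references in `t` are allocated in `S`. -/
def State.Closed (S : State L) (t : Term L) : Prop :=
  t.AllRefs (fun _ a => S.Allocated a) S.Allocated

/-- All references in `t` are bound in `S` outside of `D`, and the flow-insensitive ones carry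
the label of their binding. -/
def State.Coherent (D : Set Addr) (S : State L) (t : Term L) : Prop :=
  t.AllRefs (fun l a => a ∉ D ∧ ∃ t', S.fi a = some (l, t'))
    (fun a => a ∉ D ∧ ∃ c, S.fs a = some c)

/-- The flow-sensitive references of `t` that are visible at level `A` have a binding that is
visible at level `A`. -/
def State.Exposes [LE L] (A : L) (S : State L) (t : Term L) : Prop :=
  (t.erase A).AllRefs (fun _ _ => True) (fun a => ∃ lo ld t', S.fs a = some (lo, ld, t') ∧ lo ≤ A)

/-- The state invariant. The addresses in `D` are those that programs cannot reach. -/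
structure State.Inv [LE L] (A : L) (D : Set Addr) (S : State L) : Prop where
  allocated : ∀ a ∈ D, S.Allocated a
  fi_closed : ∀ a l t, S.fi a = some (l, t) → S.Closed t
  fs_closed : ∀ a lo ld t, S.fs a = some (lo, ld, t) → S.Closed t
  fi_coherent : ∀ a l t, S.fi a = some (l, t) → a ∉ D → S.Coherent D t
  fs_coherent : ∀ a lo ld t, S.fs a = some (lo, ld, t) → a ∉ D → S.Coherent D t
  fi_exposes : ∀ a l t, S.fi a = some (l, t) → a ∉ D → l ≤ A → S.Exposes A t
  fs_exposes : ∀ a lo ld t, S.fs a = some (lo, ld, t) → a ∉ D → lo ≤ A → ld ≤ A → S.Exposes A t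

/-- Every binding of `S` persists in `S'`, with the same outermost label. -/
structure State.Extends (S S' : State L) : Prop where
  fi : ∀ a l t, S.fi a = some (l, t) → ∃ t', S'.fi a = some (l, t')
  fs : ∀ a lo ld t, S.fs a = some (lo, ld, t) → ∃ ld' t', S'.fs a = some (lo, ld', t')

theorem State.Extends.refl (S : State L) : S.Extends S :=
  ⟨fun _ _ t h => ⟨t, h⟩, fun _ _ ld t h => ⟨ld, t, h⟩⟩

theorem State.Extends.with_cur (S : State L) (c : L) : S.Extends { S with cur := c } :=
  ⟨fun _ _ t h => ⟨t, h⟩, fun _ _ ld t h => ⟨ld, t, h⟩⟩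

theorem State.Extends.trans {S S' S'' : State L} (h : S.Extends S') (h' : S'.Extends S'') :
    S.Extends S'' := by
  refine ⟨fun a l t e => ?_, fun a lo ld t e => ?_⟩
  · obtain ⟨t', e'⟩ := h.fi a l t e
    exact h'.fi a l t' e'
  · obtain ⟨ld', t', e'⟩ := h.fs a lo ld t e
    exact h'.fs a lo ld' t' e'

theorem State.Extends.allocated {S S' : State L} (h : S.Extends S') {a : Addr}
    (ha : S.Allocated a) : S'.Allocated a := by
  rcases ha with ha | ha
  · obtain ⟨⟨l, t⟩, e⟩ := Option.ne_none_iff_exists'.1 ha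
    obtain ⟨t', e'⟩ := h.fi a l t e
    exact Or.inl (by simp [e'])
  · obtain ⟨⟨lo, ld, t⟩, e⟩ := Option.ne_none_iff_exists'.1 ha
    obtain ⟨ld', t', e'⟩ := h.fs a lo ld t e
    exact Or.inr (by simp [e'])

theorem State.Closed.mono {S S' : State L} (h : S.Extends S') {t : Term L} (ht : S.Closed t) :
    S'.Closed t :=
  Term.AllRefs.mono (fun _ _ => h.allocated) (fun _ => h.allocated) ht

theorem State.Coherent.mono {D : Set Addr} {S S' : State L} (h : S.Extends S') {t : Term L}
    (ht : S.Coherent D t) : S'.Coherent D t := by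
  refine Term.AllRefs.mono ?_ ?_ ht
  · rintro l a ⟨ha, t', e⟩
    exact ⟨ha, h.fi a l t' e⟩
  · rintro a ⟨ha, ⟨lo, ld, t'⟩, e⟩
    obtain ⟨ld', t'', e'⟩ := h.fs a lo ld t' e
    exact ⟨ha, _, e'⟩

theorem State.Exposes.mono [LE L] {A : L} {S S' : State L} (h : S.Extends S') {t : Term L}
    (ht : S.Exposes A t) : S'.Exposes A t := by
  refine Term.AllRefs.mono (fun _ _ _ => trivial) ?_ ht
  rintro a ⟨lo, ld, t', e, hlo⟩
  obtain ⟨ld', t'', e'⟩ := h.fs a lo ld t' e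
  exact ⟨lo, ld', t'', e', hlo⟩

theorem State.Coherent.closed {D : Set Addr} {S : State L} {t : Term L} (ht : S.Coherent D t) :
    S.Closed t := by
  refine Term.AllRefs.mono ?_ ?_ ht
  · rintro l a ⟨-, t', e⟩
    exact Or.inl (by simp [e])
  · rintro a ⟨-, c, e⟩
    exact Or.inr (by simp [e])

theorem State.Inv.with_cur [LE L] {A : L} {D : Set Addr} {S : State L} (h : S.Inv A D) (c : L) :
    ({ S with cur := c } : State L).Inv A D :=
  ⟨h.1, h.2, h.3, h.4, h.5, h.6, h.7⟩

theorem State.Extends.update_fi {S : State L} {a : Addr} {l : L}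
    (ha : S.fi a = none ∨ ∃ t', S.fi a = some (l, t')) (t : Term L) :
    S.Extends { S with fi := Function.update S.fi a (some (l, t)) } := by
  refine ⟨fun b l' t' e => ?_, fun b lo ld t' e => ⟨ld, t', e⟩⟩
  by_cases hb : b = a
  · subst hb
    rcases ha with ha | ⟨t'', ha⟩ <;> simp_all
  · exact ⟨t', by simpa [Function.update_of_ne hb] using e⟩

theorem State.Extends.update_fs {S : State L} {a : Addr} {lo : L}
    (ha : S.fs a = none ∨ ∃ ld' t', S.fs a = some (lo, ld', t')) (ld : L) (t : Term L) :
    S.Extends { S with fs := Function.update S.fs a (some (lo, ld, t)) } := by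
  refine ⟨fun b l' t' e => ⟨t', e⟩, fun b lo' ld' t' e => ?_⟩
  by_cases hb : b = a
  · subst hb
    rcases ha with ha | ⟨ld'', t'', ha⟩ <;> simp_all
  · exact ⟨ld', t', by simpa [Function.update_of_ne hb] using e⟩

theorem State.Inv.update_fi [LE L] {A : L} {D : Set Addr} {S : State L} (h : S.Inv A D)
    {a : Addr} {l : L} {t : Term L} (ha : S.fi a = none ∨ ∃ t', S.fi a = some (l, t'))
    (ht : S.Coherent D t) (hv : l ≤ A → S.Exposes A t) :
    ({ S with fi := Function.update S.fi a (some (l, t)) } : State L).Inv A D := by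
  have hx := State.Extends.update_fi ha t
  have key : ∀ b l' t', Function.update S.fi a (some (l, t)) b = some (l', t') →
      (l' = l ∧ t' = t) ∨ S.fi b = some (l', t') := by
    intro b l' t' e
    by_cases hb : b = a
    · subst hb
      simp only [Function.update_self, Option.some.injEq, Prod.mk.injEq] at e
      exact Or.inl ⟨e.1.symm, e.2.symm⟩
    · exact Or.inr (by rwa [Function.update_of_ne hb] at e)
  refine ⟨fun b hb => hx.allocated (h.allocated b hb), ?_, ?_, ?_, ?_, ?_, ?_⟩
  · intro b l' t' e
    rcases key b l' t' e with ⟨rfl, rfl⟩ | e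
    · exact ht.closed.mono hx
    · exact (h.fi_closed _ _ _ e).mono hx
  · intro b lo ld t' e
    exact (h.fs_closed _ _ _ _ e).mono hx
  · intro b l' t' e hb
    rcases key b l' t' e with ⟨rfl, rfl⟩ | e
    · exact ht.mono hx
    · exact (h.fi_coherent _ _ _ e hb).mono hx
  · intro b lo ld t' e hb
    exact (h.fs_coherent _ _ _ _ e hb).mono hx
  · intro b l' t' e hb hl
    rcases key b l' t' e with ⟨rfl, rfl⟩ | e
    · exact (hv hl).mono hx
    · exact (h.fi_exposes _ _ _ e hb hl).mono hx
  · intro b lo ld t' e hb h₁ h₂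
    exact (h.fs_exposes _ _ _ _ e hb h₁ h₂).mono hx

theorem State.Inv.update_fs [LE L] {A : L} {D : Set Addr} {S : State L} (h : S.Inv A D)
    {a : Addr} {lo ld : L} {t : Term L}
    (ha : S.fs a = none ∨ ∃ ld' t', S.fs a = some (lo, ld', t'))
    (ht : S.Coherent D t) (hv : lo ≤ A → ld ≤ A → S.Exposes A t) :
    ({ S with fs := Function.update S.fs a (some (lo, ld, t)) } : State L).Inv A D := by
  have hx := State.Extends.update_fs ha ld t
  have key : ∀ b lo' ld' t', Function.update S.fs a (some (lo, ld, t)) b = some (lo', ld', t') →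
      (lo' = lo ∧ ld' = ld ∧ t' = t) ∨ S.fs b = some (lo', ld', t') := by
    intro b lo' ld' t' e
    by_cases hb : b = a
    · subst hb
      simp only [Function.update_self, Option.some.injEq, Prod.mk.injEq] at e
      exact Or.inl ⟨e.1.symm, e.2.1.symm, e.2.2.symm⟩
    · exact Or.inr (by rwa [Function.update_of_ne hb] at e)
  refine ⟨fun b hb => hx.allocated (h.allocated b hb), ?_, ?_, ?_, ?_, ?_, ?_⟩
  · intro b l' t' e
    exact (h.fi_closed _ _ _ e).mono hx
  · intro b lo' ld' t' e
    rcases key b lo' ld' t' e with ⟨rfl, rfl, rfl⟩ | e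
    · exact ht.closed.mono hx
    · exact (h.fs_closed _ _ _ _ e).mono hx
  · intro b l' t' e hb
    exact (h.fi_coherent _ _ _ e hb).mono hx
  · intro b lo' ld' t' e hb
    rcases key b lo' ld' t' e with ⟨rfl, rfl, rfl⟩ | e
    · exact ht.mono hx
    · exact (h.fs_coherent _ _ _ _ e hb).mono hx
  · intro b l' t' e hb hl
    exact (h.fi_exposes _ _ _ e hb hl).mono hx
  · intro b lo' ld' t' e hb h₁ h₂
    rcases key b lo' ld' t' e with ⟨rfl, rfl, rfl⟩ | e
    · exact (hv h₁ h₂).mono hx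
    · exact (h.fs_exposes _ _ _ _ e hb h₁ h₂).mono hx

theorem State.fi_eq_none {S : State L} {a : Addr} (ha : ¬ S.Allocated a) : S.fi a = none := by
  simp only [State.Allocated, not_or, not_not] at ha; exact ha.1

theorem State.fs_eq_none {S : State L} {a : Addr} (ha : ¬ S.Allocated a) : S.fs a = none := by
  simp only [State.Allocated, not_or, not_not] at ha; exact ha.2

/-- The invariant of configurations. -/
structure State.Good [LE L] (A : L) (D : Set Addr) (S : State L) (t : Term L) : Prop where
  inv : S.Inv A D
  coherent : S.Coherent D t
  exposes : S.cur ≤ A → S.Exposes A t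

end Invariant

section Preservation

variable {L : Type*} [Lattice L] {A : L} {D : Set Addr}

theorem State.exposes_lb {S : State L} {l : L} {t : Term L} :
    S.Exposes A (.lb l t) ↔ (l ≤ A → S.Exposes A t) := by
  by_cases hl : l ≤ A <;> simp [State.Exposes, Term.erase, hl, Term.AllRefs]

theorem PureStep.good {S : State L} {t t' : Term L} (hp : PureStep t t') (h : S.Good A D t) :
    S.Good A D t' :=
  ⟨h.inv, hp.allRefs h.coherent, fun hl => (hp.erase A).allRefs (h.exposes hl)⟩

theorem Action.cur_le {S S' : State L} {t r : Term L} (h : Action S t S' r) :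
    S.cur ≤ S'.cur := by
  cases h <;> simp

theorem Eval.cur_le {S S' : State L} {t v : Term L} (h : Eval S t S' v) : S.cur ≤ S'.cur := by
  induction h with
  | value => exact le_rfl
  | pure _ _ ih => exact ih
  | bind _ _ ih ih' => exact ih.trans ih'
  | toLabeled => exact le_rfl
  | action h => exact h.cur_le

theorem Action.good {S S' : State L} {t r : Term L} (h : Action S t S' r) (hg : S.Good A D t) :
    S'.Good A D r ∧ S.Extends S' := by
  obtain ⟨hi, hc, he⟩ := hg
  cases h with
  | ret => exact ⟨⟨hi, hc, he⟩, .refl _⟩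
  | getLabel => exact ⟨⟨hi, trivial, fun _ => trivial⟩, .refl _⟩
  | label l t hl =>
    exact ⟨⟨hi, hc.2, fun hl' => State.exposes_lb.2 fun _ => (he hl').2⟩, .refl _⟩
  | unlabel l t =>
    refine ⟨⟨hi.with_cur _, hc, fun hl => ?_⟩, .with_cur _ _⟩
    exact State.exposes_lb.1 (he (le_sup_left.trans hl)) (le_sup_right.trans hl)
  | newRefFI l t a hl ha =>
    have hn : S.fi a = none ∨ ∃ t', S.fi a = some (l, t') := Or.inl (State.fi_eq_none ha)
    have hD : a ∉ D := fun h => ha (hi.allocated a h)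
    refine ⟨⟨hi.update_fi hn hc.2 fun h => (he (hl.trans h)).2, ⟨hD, t, by simp⟩,
      fun _ => trivial⟩, .update_fi hn t⟩
  | readRefFI l a l' t ha =>
    refine ⟨⟨hi.with_cur _, hi.fi_coherent _ _ _ ha hc.1, fun hl => ?_⟩, .with_cur _ _⟩
    exact hi.fi_exposes _ _ _ ha hc.1 (le_sup_right.trans hl)
  | writeRefFI l a t hl =>
    have hn := Or.inr (a := S.fi a = none) hc.1.2
    exact ⟨⟨hi.update_fi hn hc.2 fun h => (he (hl.trans h)).2, trivial, fun _ => trivial⟩,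
      .update_fi hn t⟩
  | copyRef l₁ a₁ l₂ a₂ t h₁ h₂ ha =>
    have hn := Or.inr (a := S.fi a₂ = none) hc.2.2
    exact ⟨⟨hi.update_fi hn (hi.fi_coherent _ _ _ ha hc.1.1)
      fun h => hi.fi_exposes _ _ _ ha hc.1.1 (h₁.trans h), trivial, fun _ => trivial⟩,
      .update_fi hn t⟩
  | newRefFS l t a hl ha =>
    have hn : S.fs a = none ∨ ∃ ld' t', S.fs a = some (S.cur, ld', t') :=
      Or.inl (State.fs_eq_none ha)
    have hD : a ∉ D := fun h => ha (hi.allocated a h)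
    exact ⟨⟨hi.update_fs hn hc.2 fun h _ => (he h).2, ⟨hD, _, by simp; rfl⟩,
      fun h => ⟨S.cur, l, t, by simp, h⟩⟩, .update_fs hn l t⟩
  | readRefFS a lo ld t ha =>
    refine ⟨⟨hi.with_cur _, hi.fs_coherent _ _ _ _ ha hc.1, fun hl => ?_⟩, .with_cur _ _⟩
    have hl' := le_sup_right.trans hl
    exact hi.fs_exposes _ _ _ _ ha hc.1 (le_sup_left.trans hl') (le_sup_right.trans hl')
  | writeRefFS a lo ld t t' ha hl =>
    have hn : S.fs a = none ∨ ∃ ld' t', S.fs a = some (lo, ld', t') := Or.inr ⟨ld, t', ha⟩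
    exact ⟨⟨hi.update_fs hn hc.2 fun h h' => (he (hl.trans (sup_le h h'))).2, trivial,
      fun _ => trivial⟩, .update_fs hn ld t⟩
  | writeRefFSFail a lo ld t t' ha hl =>
    exact ⟨⟨hi.with_cur _, trivial, fun _ => trivial⟩, .with_cur _ _⟩
  | labelOfFS a lo ld t ha =>
    exact ⟨⟨hi.with_cur _, trivial, fun _ => trivial⟩, .with_cur _ _⟩
  | upgrade a lo ld l t ha hl =>
    have hn : S.fs a = none ∨ ∃ ld' t', S.fs a = some (lo, ld', t') := Or.inr ⟨ld, t, ha⟩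
    exact ⟨⟨hi.update_fs hn (hi.fs_coherent _ _ _ _ ha hc.1.1)
      fun h h' => hi.fs_exposes _ _ _ _ ha hc.1.1 h (le_sup_left.trans h'), trivial,
      fun _ => trivial⟩, .update_fs hn _ t⟩
  | downgrade a lo ld l t ha hl =>
    have hn : S.fs a = none ∨ ∃ ld' t', S.fs a = some (lo, ld', t') := Or.inr ⟨ld, t, ha⟩
    exact ⟨⟨hi.update_fs hn trivial fun _ _ => trivial, trivial,
      fun _ => trivial⟩, .update_fs hn _ _⟩

theorem State.Good.bind_left {S : State L} {t u : Term L} (h : S.Good A D (.bind t u)) :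
    S.Good A D t :=
  ⟨h.inv, h.coherent.1, fun hl => (h.exposes hl).1⟩

theorem State.Good.bind_app {S S' : State L} {t r u : Term L} (h : S.Good A D (.bind t u))
    (h' : S'.Good A D (.lio r)) (hx : S.Extends S') (hl : S.cur ≤ S'.cur) :
    S'.Good A D (.app u r) :=
  ⟨h'.inv, ⟨State.Coherent.mono hx h.coherent.2, h'.coherent⟩,
    fun hA => ⟨State.Exposes.mono hx (h.exposes (hl.trans hA)).2, h'.exposes hA⟩⟩

theorem State.Good.toLabeled_right {S : State L} {l t : Term L}
    (h : S.Good A D (.toLabeled l t)) : S.Good A D t :=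
  ⟨h.inv, h.coherent.2, fun hl => (h.exposes hl).2⟩

theorem Eval.good {S S' : State L} {t v : Term L} (h : Eval S t S' v) (hg : S.Good A D t) :
    S'.Good A D v ∧ S.Extends S' := by
  induction h with
  | value => exact ⟨hg, .refl _⟩
  | pure hp _ ih => exact ih (hp.good hg)
  | bind h _ ih ih' =>
    obtain ⟨hg', hx⟩ := ih hg.bind_left
    obtain ⟨hg'', hx'⟩ := ih' (hg.bind_app hg' hx h.cur_le)
    exact ⟨hg'', hx.trans hx'⟩
  | toLabeled _ _ hl ih =>
    obtain ⟨hg', hx⟩ := ih hg.toLabeled_right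
    exact ⟨⟨hg'.inv.with_cur _, hg'.coherent,
      fun _ => State.exposes_lb.2 fun h => hg'.exposes (hl.trans h)⟩, hx.fi, hx.fs⟩
  | action h =>
    obtain ⟨hg', hx⟩ := h.good hg
    exact ⟨⟨hg'.inv, hg'.coherent, hg'.exposes⟩, hx⟩

end Preservation

section Observation

variable {L : Type*} [Lattice L] {A : L} {D : Set Addr}

open Classical in
/-- The part of a flow-insensitive binding that is visible at level `A`. -/
noncomputable def obsFI (A : L) (o : Option (L × Term L)) : Option (L × Term L) :=
  o.bind fun c => if c.1 ≤ A then some (c.1, c.2.erase A) else none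

open Classical in
/-- The part of a flow-sensitive binding that is visible at level `A`. -/
noncomputable def obsFS (A : L) (o : Option (L × L × Term L)) : Option (L × L × Term L) :=
  o.bind fun c =>
    if c.1 ≤ A then some (c.1, c.2.1, if c.2.1 ≤ A then c.2.2.erase A else .hole) else none

/-- The stores of the two states are indistinguishable at level `A`. -/
structure State.SameObs (A : L) (S S' : State L) : Prop where
  fi : ∀ a, obsFI A (S'.fi a) = obsFI A (S.fi a)
  fs : ∀ a, obsFS A (S'.fs a) = obsFS A (S.fs a)

theorem State.SameObs.refl (S : State L) : S.SameObs A S := ⟨fun _ => rfl, fun _ => rfl⟩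

theorem State.SameObs.trans {S S' S'' : State L} (h : S.SameObs A S') (h' : S'.SameObs A S'') :
    S.SameObs A S'' :=
  ⟨fun a => (h'.fi a).trans (h.fi a), fun a => (h'.fs a).trans (h.fs a)⟩

theorem State.SameObs.update_fi {S : State L} {a : Addr} {c : Option (L × Term L)}
    (h : obsFI A c = obsFI A (S.fi a)) :
    S.SameObs A { S with fi := Function.update S.fi a c } := by
  refine ⟨fun b => ?_, fun _ => rfl⟩
  by_cases hb : b = a
  · subst hb; simpa using h
  · simp [Function.update_of_ne hb]

theorem State.SameObs.update_fs {S : State L} {a : Addr} {c : Option (L × L × Term L)}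
    (h : obsFS A c = obsFS A (S.fs a)) :
    S.SameObs A { S with fs := Function.update S.fs a c } := by
  refine ⟨fun _ => rfl, fun b => ?_⟩
  by_cases hb : b = a
  · subst hb; simpa using h
  · simp [Function.update_of_ne hb]

theorem Action.sameObs {S S' : State L} {t r : Term L} (h : Action S t S' r)
    (hg : S.Good A D t) (hh : ¬ S.cur ≤ A) : S.SameObs A S' := by
  have hc := hg.coherent
  cases h with
  | ret | getLabel | label => exact .refl _
  | unlabel | readRefFI | readRefFS | writeRefFSFail | labelOfFS =>
    exact ⟨fun _ => rfl, fun _ => rfl⟩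
  | newRefFI l t a hl ha =>
    have hlA : ¬ l ≤ A := fun h => hh (hl.trans h)
    exact .update_fi (by simp [obsFI, State.fi_eq_none ha, hlA])
  | writeRefFI l a t hl =>
    have hlA : ¬ l ≤ A := fun h => hh (hl.trans h)
    obtain ⟨t', e⟩ := hc.1.2
    exact .update_fi (by simp [obsFI, e, hlA])
  | copyRef l₁ a₁ l₂ a₂ t h₁ h₂ ha =>
    have hlA : ¬ l₂ ≤ A := fun h => hh (h₂.trans h)
    obtain ⟨t', e⟩ := hc.2.2
    exact .update_fi (by simp [obsFI, e, hlA])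
  | newRefFS l t a hl ha =>
    exact .update_fs (by simp [obsFS, State.fs_eq_none ha, hh])
  | writeRefFS a lo ld t t' ha hl =>
    refine .update_fs ?_
    by_cases h₁ : lo ≤ A
    · have h₂ : ¬ ld ≤ A := fun h => hh (hl.trans (sup_le h₁ h))
      simp [obsFS, ha, h₂]
    · simp [obsFS, ha, h₁]
  | upgrade a lo ld l t ha hl =>
    have hlA : ¬ lo ≤ A := fun h => hh (hl.trans h)
    exact .update_fs (by simp [obsFS, ha, hlA])
  | downgrade a lo ld l t ha hl =>
    have hlA : ¬ lo ≤ A := fun h => hh (hl.trans h)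
    exact .update_fs (by simp [obsFS, ha, hlA])

theorem Eval.sameObs {S S' : State L} {t v : Term L} (h : Eval S t S' v)
    (hg : S.Good A D t) (hh : ¬ S.cur ≤ A) : S.SameObs A S' := by
  induction h with
  | value => exact .refl _
  | pure hp _ ih => exact ih (hp.good hg) hh
  | bind h _ ih ih' =>
    obtain ⟨hg', hx⟩ := h.good hg.bind_left
    exact (ih hg.bind_left hh).trans
      (ih' (hg.bind_app hg' hx h.cur_le) fun hA => hh (h.cur_le.trans hA))
  | toLabeled _ _ _ ih =>
    have := ih hg.toLabeled_right hh
    exact ⟨this.fi, this.fs⟩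
  | action h => exact h.sameObs hg hh

end Observation

section Agreement

variable {L : Type*}

/-- `π'` agrees with `π` on the addresses that are allocated in `S₁` and whose image is allocated
in `S₂`. -/
def AgreeOn (S₁ S₂ : State L) (π π' : Equiv.Perm Addr) : Prop :=
  ∀ a, S₁.Allocated a → S₂.Allocated (π a) → π' a = π a

theorem AgreeOn.refl (S₁ S₂ : State L) (π : Equiv.Perm Addr) : AgreeOn S₁ S₂ π π :=
  fun _ _ _ => rfl

theorem AgreeOn.trans {S₁ S₂ S₁' S₂' : State L} {π π' π'' : Equiv.Perm Addr}
    (h : AgreeOn S₁ S₂ π π') (h' : AgreeOn S₁' S₂' π' π'') (h₁ : S₁.Extends S₁')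
    (h₂ : S₂.Extends S₂') : AgreeOn S₁ S₂ π π'' := by
  intro a ha ha'
  have e := h a ha ha'
  rw [h' a (h₁.allocated ha) (by rw [e]; exact h₂.allocated ha'), e]

theorem AgreeOn.rename_eq {S₁ S₂ : State L} {π π' : Equiv.Perm Addr} (h : AgreeOn S₁ S₂ π π')
    {t : Term L} (h₁ : S₁.Closed t) (h₂ : S₂.Closed (t.rename π)) :
    t.rename π' = t.rename π := by
  apply Term.AllRefs.rename_congr
  have h₂' := (Term.allRefs_rename _ _).1 h₂
  exact (Term.AllRefs.and h₁ h₂').mono (fun _ a H => h a H.1 H.2) (fun a H => h a H.1 H.2)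

end Agreement

section Simulation

variable {L : Type*} [Lattice L] {A : L} {D : Set Addr}

/-- The terms are equal after erasure and renaming of the addresses of the first one. -/
def Term.Related (A : L) (π : Equiv.Perm Addr) (t₁ t₂ : Term L) : Prop :=
  (t₁.erase A).rename π = t₂.erase A

/-- The visible parts of the stores are equal up to a renaming that fixes `D`. -/
structure State.Related (A : L) (D : Set Addr) (π : Equiv.Perm Addr) (S₁ S₂ : State L) :
    Prop where
  fixes : ∀ a ∈ D, π a = a
  fi : ∀ a, (obsFI A (S₁.fi a)).map (fun c => (c.1, c.2.rename π)) = obsFI A (S₂.fi (π a))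
  fs : ∀ a, (obsFS A (S₁.fs a)).map (fun c => (c.1, c.2.1, c.2.2.rename π)) =
    obsFS A (S₂.fs (π a))

/-- Low equivalence of two configurations along a renaming. -/
structure Similar (A : L) (D : Set Addr) (π : Equiv.Perm Addr) (S₁ : State L) (t₁ : Term L)
    (S₂ : State L) (t₂ : Term L) : Prop where
  state : State.Related A D π S₁ S₂
  term : S₁.cur ≤ A ∨ S₂.cur ≤ A → S₁.cur = S₂.cur ∧ Term.Related A π t₁ t₂

theorem Term.Related.congr {S₁ S₂ : State L} {π π' : Equiv.Perm Addr}
    (h : AgreeOn S₁ S₂ π π') {t₁ t₂ : Term L} (h₁ : S₁.Closed t₁) (h₂ : S₂.Closed t₂)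
    (ht : Term.Related A π t₁ t₂) : Term.Related A π' t₁ t₂ := by
  unfold Term.Related at *
  rw [h.rename_eq (h₁.erase A) (by rw [ht]; exact h₂.erase A), ht]

theorem obsFI_some {l : L} {t : Term L} (hl : l ≤ A) :
    obsFI A (some (l, t)) = some (l, t.erase A) := by
  simp [obsFI, hl]

theorem obsFI_closed {S : State L} {o : Option (L × Term L)}
    (h : ∀ l t, o = some (l, t) → S.Closed t) {l : L} {t : Term L}
    (e : obsFI A o = some (l, t)) : S.Closed t := by
  rcases o with _ | ⟨l', t'⟩
  · simp [obsFI] at e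
  · by_cases hl : l' ≤ A <;> simp [obsFI, hl] at e
    obtain ⟨rfl, rfl⟩ := e
    exact (h _ _ rfl).erase A

theorem obsFS_closed {S : State L} {o : Option (L × L × Term L)}
    (h : ∀ lo ld t, o = some (lo, ld, t) → S.Closed t) {lo ld : L} {t : Term L}
    (e : obsFS A o = some (lo, ld, t)) : S.Closed t := by
  rcases o with _ | ⟨lo', ld', t'⟩
  · simp [obsFS] at e
  · by_cases hl : lo' ≤ A <;> simp [obsFS, hl] at e
    obtain ⟨rfl, rfl, e⟩ := e
    split_ifs at e
    · exact e ▸ (h _ _ _ rfl).erase A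
    · exact e ▸ trivial

theorem State.Related.fi_lookup {π : Equiv.Perm Addr} {S₁ S₂ : State L}
    (h : State.Related A D π S₁ S₂) {a : Addr} {l : L} {t₁ : Term L}
    (e : S₁.fi a = some (l, t₁)) (hl : l ≤ A) :
    ∃ t₂, S₂.fi (π a) = some (l, t₂) ∧ Term.Related A π t₁ t₂ := by
  have := h.fi a
  rw [e, obsFI_some hl] at this
  rcases e' : S₂.fi (π a) with _ | ⟨l', t'⟩
  · simp [e', obsFI] at this
  · by_cases hl' : l' ≤ A <;> simp [e', obsFI, hl'] at this
    obtain ⟨rfl, H⟩ := this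
    exact ⟨t', rfl, H⟩

theorem State.Related.fs_lookup {π : Equiv.Perm Addr} {S₁ S₂ : State L}
    (h : State.Related A D π S₁ S₂) {a : Addr} {lo ld : L} {t₁ : Term L}
    (e : S₁.fs a = some (lo, ld, t₁)) (hl : lo ≤ A) :
    ∃ t₂, S₂.fs (π a) = some (lo, ld, t₂) ∧ (ld ≤ A → Term.Related A π t₁ t₂) := by
  have := h.fs a
  rcases e' : S₂.fs (π a) with _ | ⟨lo', ld', t'⟩
  · simp [e, e', obsFS, hl] at this
  · by_cases hl' : lo' ≤ A <;> simp [e, e', obsFS, hl, hl'] at this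
    obtain ⟨rfl, rfl, H⟩ := this
    exact ⟨t', rfl, fun hd => by simpa [hd, Term.Related] using H⟩

theorem State.Related.update_fi {π : Equiv.Perm Addr} {S₁ S₂ : State L}
    (h : State.Related A D π S₁ S₂) {a : Addr} {l : L} {t₁ t₂ : Term L}
    (ht : l ≤ A → Term.Related A π t₁ t₂) :
    State.Related A D π { S₁ with fi := Function.update S₁.fi a (some (l, t₁)) }
      { S₂ with fi := Function.update S₂.fi (π a) (some (l, t₂)) } := by
  refine ⟨h.fixes, fun b => ?_, h.fs⟩
  by_cases hb : b = a
  · subst hb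
    by_cases hl : l ≤ A
    · simpa [obsFI, hl, Term.Related] using ht hl
    · simp [obsFI, hl]
  · simpa [Function.update_of_ne hb, Function.update_of_ne (π.injective.ne hb)] using h.fi b

theorem State.Related.update_fs {π : Equiv.Perm Addr} {S₁ S₂ : State L}
    (h : State.Related A D π S₁ S₂) {a : Addr} {lo ld : L} {t₁ t₂ : Term L}
    (ht : lo ≤ A → ld ≤ A → Term.Related A π t₁ t₂) :
    State.Related A D π { S₁ with fs := Function.update S₁.fs a (some (lo, ld, t₁)) }
      { S₂ with fs := Function.update S₂.fs (π a) (some (lo, ld, t₂)) } := by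
  refine ⟨h.fixes, h.fi, fun b => ?_⟩
  by_cases hb : b = a
  · subst hb
    by_cases hl : lo ≤ A
    · by_cases hd : ld ≤ A
      · simpa [obsFS, hl, hd, Term.Related] using ht hl hd
      · simp [obsFS, hl, hd, Term.rename]
    · simp [obsFS, hl]
  · simpa [Function.update_of_ne hb, Function.update_of_ne (π.injective.ne hb)] using h.fs b

theorem State.Related.with_cur {π : Equiv.Perm Addr} {S₁ S₂ : State L}
    (h : State.Related A D π S₁ S₂) (c₁ c₂ : L) :
    State.Related A D π { S₁ with cur := c₁ } { S₂ with cur := c₂ } :=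
  ⟨h.fixes, h.fi, h.fs⟩

/-- Addresses that are fresh on both sides can be linked. -/
theorem State.Related.exists_link {π : Equiv.Perm Addr} {S₁ S₂ : State L}
    (h : State.Related A D π S₁ S₂) (h₁ : S₁.Inv A D) (h₂ : S₂.Inv A D) {a₁ a₂ : Addr}
    (ha₁ : ¬ S₁.Allocated a₁) (ha₂ : ¬ S₂.Allocated a₂) :
    ∃ π', π' a₁ = a₂ ∧ AgreeOn S₁ S₂ π π' ∧ State.Related A D π' S₁ S₂ := by
  set π' : Equiv.Perm Addr := π.trans (Equiv.swap (π a₁) a₂) with hπ'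
  have hagree : AgreeOn S₁ S₂ π π' := by
    intro b hb hb'
    refine Equiv.swap_apply_of_ne_of_ne (fun e => ?_) (fun e => ?_)
    · exact ha₁ (π.injective e ▸ hb)
    · exact ha₂ (e ▸ hb')
  have hfix : ∀ b, b ≠ a₁ → π b ≠ a₂ → π' b = π b := fun b hb hb' =>
    Equiv.swap_apply_of_ne_of_ne (π.injective.ne hb) hb'
  have hlink : π' a₁ = a₂ := Equiv.swap_apply_left _ _
  have hother : ∀ b, π b = a₂ → b ≠ a₁ → π' b = π a₁ := fun b hb _ => by
    simp [hπ', hb]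
  refine ⟨π', hlink, hagree, fun b hb => ?_, fun b => ?_, fun b => ?_⟩
  · have := h.fixes b hb
    rw [hagree b (h₁.allocated b hb) (by rw [this]; exact h₂.allocated b hb), this]
  · by_cases hb : b = a₁
    · subst hb
      simp [hlink, State.fi_eq_none ha₁, State.fi_eq_none ha₂, obsFI]
    by_cases hb' : π b = a₂
    · have e₁ := h.fi b
      have e₂ := h.fi a₁
      rw [hb', State.fi_eq_none ha₂] at e₁
      rw [State.fi_eq_none ha₁] at e₂
      rw [hother b hb' hb, ← e₂]
      rw [show obsFI A (none : Option (L × Term L)) = none from rfl] at e₁ ⊢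
      rw [Option.map_eq_none_iff] at e₁
      simp [e₁]
    · rw [hfix b hb hb', ← h.fi b]
      rcases e : obsFI A (S₁.fi b) with _ | ⟨l, t⟩
      · rfl
      · have hc₁ := obsFI_closed (h₁.fi_closed b) e
        have e' := h.fi b
        rw [e] at e'
        have hc₂ := obsFI_closed (h₂.fi_closed (π b)) e'.symm
        simp [hagree.rename_eq hc₁ hc₂]
  · by_cases hb : b = a₁
    · subst hb
      simp [hlink, State.fs_eq_none ha₁, State.fs_eq_none ha₂, obsFS]
    by_cases hb' : π b = a₂
    · have e₁ := h.fs b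
      have e₂ := h.fs a₁
      rw [hb', State.fs_eq_none ha₂] at e₁
      rw [State.fs_eq_none ha₁] at e₂
      rw [hother b hb' hb, ← e₂]
      rw [show obsFS A (none : Option (L × L × Term L)) = none from rfl] at e₁ ⊢
      rw [Option.map_eq_none_iff] at e₁
      simp [e₁]
    · rw [hfix b hb hb', ← h.fs b]
      rcases e : obsFS A (S₁.fs b) with _ | ⟨lo, ld, t⟩
      · rfl
      · have hc₁ := obsFS_closed (h₁.fs_closed b) e
        have e' := h.fs b
        rw [e] at e'
        have hc₂ := obsFS_closed (h₂.fs_closed (π b)) e'.symm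
        simp [hagree.rename_eq hc₁ hc₂]

theorem State.Related.of_sameObs {π : Equiv.Perm Addr} {S₁ S₂ S₁' S₂' : State L}
    (h : State.Related A D π S₁ S₂) (h₁ : S₁.SameObs A S₁') (h₂ : S₂.SameObs A S₂') :
    State.Related A D π S₁' S₂' :=
  ⟨h.fixes, fun a => by rw [h₁.fi, h₂.fi, h.fi], fun a => by rw [h₁.fs, h₂.fs, h.fs]⟩

theorem Term.related_lb {π : Equiv.Perm Addr} {l l' : L} {t t' : Term L} :
    Term.Related A π (.lb l t) (.lb l' t') ↔ l = l' ∧ (l ≤ A → Term.Related A π t t') := by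
  unfold Term.Related
  by_cases hl : l ≤ A <;> by_cases hl' : l' ≤ A <;>
    simp [Term.erase, Term.rename, hl, hl'] <;> grind

theorem Term.Related.isValue_iff {π : Equiv.Perm Addr} {t t' : Term L}
    (h : Term.Related A π t t') : t.IsValue ↔ t'.IsValue := by
  rw [← Term.isValue_erase A t, ← Term.isValue_erase A t', ← h, Term.isValue_rename]

theorem Term.Related.bind_inv {π : Equiv.Perm Addr} {t u s : Term L}
    (h : Term.Related A π (.bind t u) s) :
    ∃ t' u', s = .bind t' u' ∧ Term.Related A π t t' ∧ Term.Related A π u u' := by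
  cases s <;> simp only [Term.Related, Term.erase, Term.rename] at h <;> (try split_ifs at h) <;>
    first
    | (simp at h; done)
    | (injection h with h h'; exact ⟨_, _, rfl, h, h'⟩)

theorem Term.Related.toLabeled_inv {π : Equiv.Perm Addr} {l : L} {t s : Term L}
    (h : Term.Related A π (.toLabeled (.lbl l) t) s) :
    ∃ t', s = .toLabeled (.lbl l) t' ∧ Term.Related A π t t' := by
  cases s with
  | toLabeled m t' =>
    injection h with h h'
    refine ⟨t', ?_, h'⟩
    cases m <;> simp only [Term.erase, Term.rename] at h <;> (try split_ifs at h) <;>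
      first
      | (simp at h; done)
      | (injection h with h; rw [h])
  | _ =>
    simp only [Term.Related, Term.erase, Term.rename] at h
    (try split_ifs at h) <;> simp at h

end Simulation

section Typing

variable {L : Type*}

theorem HasType.allRefs {Δ : StoreTyping} {Γ : List Ty} {t : Term L} {τ : Ty}
    (h : HasType Δ Γ t τ) :
    t.AllRefs (fun _ a => Δ .fi a ≠ none) (fun a => Δ .fs a ≠ none) := by
  induction h <;> simp_all [Term.AllRefs]

theorem HasType.closed {Δ : StoreTyping} {Γ : List Ty} {S : State L} (hS : S.WellTyped Δ Γ)
    {t : Term L} {τ : Ty} (h : HasType Δ Γ t τ) : S.Closed t :=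
  h.allRefs.mono (fun _ a ha => Or.inl (mt (hS.fi_dom a).2 ha))
    (fun a ha => Or.inr (mt (hS.fs_dom a).2 ha))

end Typing

section NonInterference

variable {L : Type*} [Lattice L] {A : L} {D : Set Addr}

theorem Action.similar {π : Equiv.Perm Addr} {S₁ S₂ S₁' S₂' : State L} {t₁ t₂ r₁ r₂ : Term L}
    (h₁ : Action S₁ t₁ S₁' r₁) (h₂ : Action S₂ t₂ S₂' r₂)
    (g₁ : S₁.Good A D t₁) (g₂ : S₂.Good A D t₂) (hs : State.Related A D π S₁ S₂)
    (hl : S₁.cur ≤ A) (hcur : S₁.cur = S₂.cur) (ht : Term.Related A π t₁ t₂) :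
    ∃ π', AgreeOn S₁ S₂ π π' ∧ State.Related A D π' S₁' S₂' ∧ S₁'.cur = S₂'.cur ∧
      (S₁'.cur ≤ A → Term.Related A π' r₁ r₂) := by
  cases h₁ <;> cases h₂ <;>
    (try first
      | (exfalso; simp [Term.Related, Term.erase, Term.rename] at ht; done)
      | (exfalso; simp only [Term.Related, Term.erase, Term.rename] at ht
         split_ifs at ht <;> simp [Term.rename] at ht <;> done))
  case ret.ret => exact ⟨π, .refl _ _ _, hs, hcur, fun _ => by injection ht⟩
  case getLabel.getLabel =>
    exact ⟨π, .refl _ _ _, hs, hcur, fun _ => by simp [Term.Related, Term.erase, Term.rename, hcur]⟩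
  case label.label l₁ t₁ _ l₂ t₂ _ =>
    simp only [Term.Related, Term.erase, Term.rename, Term.label.injEq, Term.lbl.injEq] at ht
    exact ⟨π, .refl _ _ _, hs, hcur, fun _ => Term.related_lb.2 ⟨ht.1, fun _ => ht.2⟩⟩
  case unlabel.unlabel l₁ l₂ =>
    have ht' : Term.Related A π (.lb l₁ r₁) (.lb l₂ r₂) := by injection ht
    obtain ⟨rfl, hr⟩ := Term.related_lb.1 ht'
    exact ⟨π, .refl _ _ _, hs.with_cur _ _, by rw [hcur], fun h => hr (le_sup_right.trans h)⟩
  case newRefFI.newRefFI l₁ t₁ a₁ _ ha₁ l₂ t₂ a₂ _ ha₂ =>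
    simp only [Term.Related, Term.erase, Term.rename, Term.newRef.injEq, Term.lbl.injEq,
      true_and] at ht
    obtain ⟨rfl, ht⟩ := ht
    obtain ⟨π', rfl, hag, hs'⟩ := hs.exists_link g₁.inv g₂.inv ha₁ ha₂
    exact ⟨π', hag, hs'.update_fi fun _ =>
      Term.Related.congr hag (State.Coherent.closed g₁.coherent.2)
        (State.Coherent.closed g₂.coherent.2) ht, hcur, fun _ => rfl⟩
  case readRefFI.readRefFI l₁ a₁ l₁' e₁ l₂ a₂ l₂' e₂ =>
    simp only [Term.Related, Term.erase, Term.rename, Term.readRef.injEq, Term.refFI.injEq,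
      true_and] at ht
    obtain ⟨rfl, rfl⟩ := ht
    obtain ⟨-, _, e₁'⟩ := g₁.coherent
    obtain ⟨-, _, e₂'⟩ := g₂.coherent
    obtain ⟨rfl, rfl⟩ : l₁' = l₁ ∧ l₂' = l₁ := by simp_all
    refine ⟨π, .refl _ _ _, hs.with_cur _ _, by rw [hcur], fun h => ?_⟩
    obtain ⟨t, e, H⟩ := hs.fi_lookup e₁ (le_sup_right.trans h)
    simp_all
  case writeRefFI.writeRefFI l₁ a₁ t₁ _ l₂ a₂ t₂ _ =>
    simp only [Term.Related, Term.erase, Term.rename, Term.writeRef.injEq, Term.refFI.injEq,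
      true_and] at ht
    obtain ⟨⟨rfl, rfl⟩, ht⟩ := ht
    exact ⟨π, .refl _ _ _, hs.update_fi fun _ => ht, hcur, fun _ => rfl⟩
  case copyRef.copyRef l₁ a₁ m₁ b₁ t₁ h₁ _ e₁ l₂ a₂ m₂ b₂ t₂ h₂ _ e₂ =>
    simp only [Term.Related, Term.erase, Term.rename, Term.copyRef.injEq, Term.refFI.injEq] at ht
    obtain ⟨⟨rfl, rfl⟩, rfl, rfl⟩ := ht
    refine ⟨π, .refl _ _ _, hs.update_fi fun h => ?_, hcur, fun _ => rfl⟩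
    obtain ⟨t, e, H⟩ := hs.fi_lookup e₁ (h₁.trans h)
    simp_all
  case newRefFS.newRefFS l₁ t₁ a₁ _ ha₁ l₂ t₂ a₂ _ ha₂ =>
    simp only [Term.Related, Term.erase, Term.rename, Term.newRef.injEq, Term.lbl.injEq,
      true_and] at ht
    obtain ⟨rfl, ht⟩ := ht
    obtain ⟨π', rfl, hag, hs'⟩ := hs.exists_link g₁.inv g₂.inv ha₁ ha₂
    have e : some (S₂.cur, l₁, t₂) = some (S₁.cur, l₁, t₂) := by rw [hcur]
    rw [e]
    exact ⟨π', hag, hs'.update_fs fun _ _ =>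
      Term.Related.congr hag (State.Coherent.closed g₁.coherent.2)
        (State.Coherent.closed g₂.coherent.2) ht, hcur, fun _ => rfl⟩
  case readRefFS.readRefFS a₁ lo₁ ld₁ e₁ a₂ lo₂ ld₂ e₂ =>
    obtain rfl : π a₁ = a₂ := by simpa [Term.Related, Term.erase, Term.rename] using ht
    obtain ⟨lo, ld, t, e, hlo⟩ := g₁.exposes hl
    obtain ⟨rfl, rfl, rfl⟩ : lo₁ = lo ∧ ld₁ = ld ∧ r₁ = t := by simpa [e₁] using e
    obtain ⟨t, e', H⟩ := hs.fs_lookup e₁ hlo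
    obtain ⟨rfl, rfl, rfl⟩ : lo₂ = lo₁ ∧ ld₂ = ld₁ ∧ r₂ = t := by simpa [e₂] using e'
    exact ⟨π, .refl _ _ _, hs.with_cur _ _, by rw [hcur],
      fun h => H (le_sup_right.trans (le_sup_right.trans h))⟩
  case writeRefFS.writeRefFS a₁ lo₁ ld₁ t₁ s₁ e₁ h₁ a₂ lo₂ ld₂ t₂ s₂ e₂ h₂ =>
    simp only [Term.Related, Term.erase, Term.rename, Term.writeRef.injEq, Term.refFS.injEq,
      true_and] at ht
    obtain ⟨rfl, ht⟩ := ht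
    obtain ⟨lo, ld, t, e, hlo⟩ := (g₁.exposes hl).1
    obtain ⟨rfl, rfl, rfl⟩ : lo₁ = lo ∧ ld₁ = ld ∧ s₁ = t := by simpa [e₁] using e
    obtain ⟨t, e', H⟩ := hs.fs_lookup e₁ hlo
    obtain ⟨rfl, rfl, rfl⟩ : lo₂ = lo₁ ∧ ld₂ = ld₁ ∧ s₂ = t := by simpa [e₂] using e'
    exact ⟨π, .refl _ _ _, hs.update_fs fun _ _ => ht, hcur, fun _ => rfl⟩
  case writeRefFS.writeRefFSFail a₁ lo₁ ld₁ t₁ s₁ e₁ h₁ a₂ lo₂ ld₂ t₂ s₂ e₂ h₂ =>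
    simp only [Term.Related, Term.erase, Term.rename, Term.writeRef.injEq, Term.refFS.injEq,
      true_and] at ht
    obtain ⟨rfl, ht⟩ := ht
    obtain ⟨lo, ld, t, e, hlo⟩ := (g₁.exposes hl).1
    obtain ⟨rfl, rfl, rfl⟩ : lo₁ = lo ∧ ld₁ = ld ∧ s₁ = t := by simpa [e₁] using e
    obtain ⟨t, e', H⟩ := hs.fs_lookup e₁ hlo
    obtain ⟨rfl, rfl, rfl⟩ : lo₂ = lo₁ ∧ ld₂ = ld₁ ∧ s₂ = t := by simpa [e₂] using e'
    exact absurd (hcur ▸ h₁) h₂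
  case writeRefFSFail.writeRefFS a₁ lo₁ ld₁ t₁ s₁ e₁ h₁ a₂ lo₂ ld₂ t₂ s₂ e₂ h₂ =>
    simp only [Term.Related, Term.erase, Term.rename, Term.writeRef.injEq, Term.refFS.injEq,
      true_and] at ht
    obtain ⟨rfl, ht⟩ := ht
    obtain ⟨lo, ld, t, e, hlo⟩ := (g₁.exposes hl).1
    obtain ⟨rfl, rfl, rfl⟩ : lo₁ = lo ∧ ld₁ = ld ∧ s₁ = t := by simpa [e₁] using e
    obtain ⟨t, e', H⟩ := hs.fs_lookup e₁ hlo
    obtain ⟨rfl, rfl, rfl⟩ : lo₂ = lo₁ ∧ ld₂ = ld₁ ∧ s₂ = t := by simpa [e₂] using e'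
    exact absurd (hcur ▸ h₂) h₁
  case writeRefFSFail.writeRefFSFail a₁ lo₁ ld₁ t₁ s₁ e₁ h₁ a₂ lo₂ ld₂ t₂ s₂ e₂ h₂ =>
    simp only [Term.Related, Term.erase, Term.rename, Term.writeRef.injEq, Term.refFS.injEq,
      true_and] at ht
    obtain ⟨rfl, ht⟩ := ht
    obtain ⟨lo, ld, t, e, hlo⟩ := (g₁.exposes hl).1
    obtain ⟨rfl, rfl, rfl⟩ : lo₁ = lo ∧ ld₁ = ld ∧ s₁ = t := by simpa [e₁] using e
    obtain ⟨t, e', H⟩ := hs.fs_lookup e₁ hlo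
    obtain ⟨rfl, rfl, rfl⟩ : lo₂ = lo₁ ∧ ld₂ = ld₁ ∧ s₂ = t := by simpa [e₂] using e'
    exact ⟨π, .refl _ _ _, hs.with_cur _ _, by rw [hcur], fun _ => rfl⟩
  case labelOfFS.labelOfFS a₁ lo₁ ld₁ s₁ e₁ a₂ lo₂ ld₂ s₂ e₂ =>
    obtain rfl : π a₁ = a₂ := by simpa [Term.Related, Term.erase, Term.rename] using ht
    obtain ⟨lo, ld, t, e, hlo⟩ := g₁.exposes hl
    obtain ⟨rfl, rfl, rfl⟩ : lo₁ = lo ∧ ld₁ = ld ∧ s₁ = t := by simpa [e₁] using e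
    obtain ⟨t, e', H⟩ := hs.fs_lookup e₁ hlo
    obtain ⟨rfl, rfl, rfl⟩ : lo₂ = lo₁ ∧ ld₂ = ld₁ ∧ s₂ = t := by simpa [e₂] using e'
    exact ⟨π, .refl _ _ _, hs.with_cur _ _, by rw [hcur], fun _ => rfl⟩
  case upgrade.upgrade a₁ lo₁ ld₁ l₁ s₁ e₁ _ a₂ lo₂ ld₂ l₂ s₂ e₂ _ =>
    obtain ⟨rfl, rfl⟩ : π a₁ = a₂ ∧ l₁ = l₂ := by
      simpa [Term.Related, Term.erase, Term.rename] using ht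
    obtain ⟨lo, ld, t, e, hlo⟩ := (g₁.exposes hl).1
    obtain ⟨rfl, rfl, rfl⟩ : lo₁ = lo ∧ ld₁ = ld ∧ s₁ = t := by simpa [e₁] using e
    obtain ⟨t, e', H⟩ := hs.fs_lookup e₁ hlo
    obtain ⟨rfl, rfl, rfl⟩ : lo₂ = lo₁ ∧ ld₂ = ld₁ ∧ s₂ = t := by simpa [e₂] using e'
    exact ⟨π, .refl _ _ _, hs.update_fs fun _ h => H (le_sup_left.trans h), hcur, fun _ => rfl⟩
  case downgrade.downgrade a₁ lo₁ ld₁ l₁ s₁ e₁ _ a₂ lo₂ ld₂ l₂ s₂ e₂ _ =>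
    obtain ⟨rfl, rfl⟩ : π a₁ = a₂ ∧ l₁ = l₂ := by
      simpa [Term.Related, Term.erase, Term.rename] using ht
    obtain ⟨lo, ld, t, e, hlo⟩ := (g₁.exposes hl).1
    obtain ⟨rfl, rfl, rfl⟩ : lo₁ = lo ∧ ld₁ = ld ∧ s₁ = t := by simpa [e₁] using e
    obtain ⟨t, e', H⟩ := hs.fs_lookup e₁ hlo
    obtain ⟨rfl, rfl, rfl⟩ : lo₂ = lo₁ ∧ ld₂ = ld₁ ∧ s₂ = t := by simpa [e₂] using e'
    exact ⟨π, .refl _ _ _, hs.update_fs fun _ _ => rfl, hcur, fun _ => rfl⟩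

theorem Eval.similar_of_high {π : Equiv.Perm Addr} {S₁ S₂ S₁' S₂' : State L}
    {t₁ t₂ v₁ v₂ : Term L} (h₁ : Eval S₁ t₁ S₁' v₁) (h₂ : Eval S₂ t₂ S₂' v₂)
    (g₁ : S₁.Good A D t₁) (g₂ : S₂.Good A D t₂) (hs : Similar A D π S₁ t₁ S₂ t₂)
    (hh : ¬ S₁.cur ≤ A) :
    ∃ π', AgreeOn S₁ S₂ π π' ∧ Similar A D π' S₁' v₁ S₂' v₂ := by
  have hh₂ : ¬ S₂.cur ≤ A := fun h => hh ((hs.term (Or.inr h)).1 ▸ h)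
  refine ⟨π, .refl _ _ _, hs.state.of_sameObs (h₁.sameObs g₁ hh) (h₂.sameObs g₂ hh₂), ?_⟩
  rintro (h | h)
  · exact absurd (h₁.cur_le.trans h) hh
  · exact absurd (h₂.cur_le.trans h) hh₂

/-- Two terminating evaluations of similar configurations end in similar configurations. -/
theorem Eval.similar {π : Equiv.Perm Addr} {S₁ S₂ S₁' S₂' : State L} {t₁ t₂ v₁ v₂ : Term L}
    (h₁ : Eval S₁ t₁ S₁' v₁) (h₂ : Eval S₂ t₂ S₂' v₂)
    (g₁ : S₁.Good A D t₁) (g₂ : S₂.Good A D t₂) (hs : Similar A D π S₁ t₁ S₂ t₂) :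
    ∃ π', AgreeOn S₁ S₂ π π' ∧ Similar A D π' S₁' v₁ S₂' v₂ := by
  induction h₁ generalizing π S₂ S₂' t₂ v₂ with
  | @value S v hv =>
    by_cases hl : S.cur ≤ A
    · obtain ⟨rfl, rfl⟩ := h₂.eq_of_isValue ((hs.term (Or.inl hl)).2.isValue_iff.1 hv)
      exact ⟨π, .refl _ _ _, hs⟩
    · exact (Eval.value S hv).similar_of_high h₂ g₁ g₂ hs hl
  | @pure S S' t t' v hp h ih =>
    by_cases hl : S.cur ≤ A
    · obtain ⟨hcur, ht⟩ := hs.term (Or.inl hl)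
      have hp' := (hp.erase A).rename π
      rw [ht] at hp'
      obtain ⟨s, hp''⟩ : ∃ s, PureStep (t₂.erase A) s := ⟨_, hp'⟩
      cases h₂ with
      | value _ hv => exact absurd (ht.isValue_iff.2 hv) hp.not_isValue
      | pure hq h₂ =>
        exact ih h₂ (hp.good g₁) (hq.good g₂)
          ⟨hs.state, fun _ => ⟨hcur, hp'.deterministic (hq.erase A)⟩⟩
      | bind => cases hp''
      | toLabeled =>
        cases hp'' with
        | toLabeledCtx _ h => cases h
      | action ha =>
        rw [← Term.rename_id (Term.erase A t₂)] at hp''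
        exact absurd ha hp''.not_erased_action
    · exact (Eval.pure hp h).similar_of_high h₂ g₁ g₂ hs hl
  | @bind S S' S'' t r u v h h' ih ih' =>
    by_cases hl : S.cur ≤ A
    · obtain ⟨hcur, ht⟩ := hs.term (Or.inl hl)
      obtain ⟨t', u', rfl, htt, huu⟩ := ht.bind_inv
      obtain ⟨Sm, r', k, k'⟩ := h₂.bind_inv
      obtain ⟨π₁, hag, hs₁⟩ := ih k g₁.bind_left g₂.bind_left ⟨hs.state, fun _ => ⟨hcur, htt⟩⟩
      obtain ⟨gm₁, hx₁⟩ := h.good g₁.bind_left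
      obtain ⟨gm₂, hx₂⟩ := k.good g₂.bind_left
      have huu' := Term.Related.congr hag (State.Coherent.closed g₁.coherent.2)
        (State.Coherent.closed g₂.coherent.2) huu
      obtain ⟨π₂, hag', hs₂⟩ := ih' k' (g₁.bind_app gm₁ hx₁ h.cur_le)
        (g₂.bind_app gm₂ hx₂ k.cur_le) (π := π₁)
        ⟨hs₁.state, fun H => ⟨(hs₁.term H).1, by
          have := (hs₁.term H).2
          simp only [Term.Related, Term.erase, Term.rename, Term.lio.injEq] at this huu' ⊢
          rw [this, huu']⟩⟩
      exact ⟨π₂, hag.trans hag' hx₁ hx₂, hs₂⟩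
    · exact (Eval.bind h h').similar_of_high h₂ g₁ g₂ hs hl
  | @toLabeled S S' l t r hle h hle' ih =>
    by_cases hl : S.cur ≤ A
    · obtain ⟨hcur, ht⟩ := hs.term (Or.inl hl)
      obtain ⟨t', rfl, htt⟩ := ht.toLabeled_inv
      obtain ⟨Sm, r', -, k, -, rfl, rfl⟩ := h₂.toLabeled_inv
      obtain ⟨π₁, hag, hs₁⟩ := ih k g₁.toLabeled_right g₂.toLabeled_right
        ⟨hs.state, fun _ => ⟨hcur, htt⟩⟩
      refine ⟨π₁, hag, hs₁.state.with_cur _ _, fun _ => ⟨hcur, ?_⟩⟩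
      have : Term.Related A π₁ (.lb l r) (.lb l r') := Term.related_lb.2 ⟨rfl, fun hlA => by
        have := (hs₁.term (Or.inl (hle'.trans hlA))).2
        injection this⟩
      exact congrArg Term.lio this
    · exact (Eval.toLabeled hle h hle').similar_of_high h₂ g₁ g₂ hs hl
  | @action S S' t r ha =>
    by_cases hl : S.cur ≤ A
    · obtain ⟨hcur, ht⟩ := hs.term (Or.inl hl)
      cases h₂ with
      | value _ hv => exact absurd (ht.isValue_iff.2 hv) ha.not_isValue
      | pure hq h₂ =>
        have hq' := hq.erase A
        rw [← ht] at hq'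
        exact absurd ha hq'.not_erased_action
      | bind => cases ha <;> exact absurd ht (by
          simp only [Term.Related, Term.erase, Term.rename]; simp)
      | toLabeled => cases ha <;> exact absurd ht (by
          simp only [Term.Related, Term.erase, Term.rename]; simp)
      | action hb =>
        obtain ⟨π', hag, hs', hcur', hr⟩ := ha.similar hb g₁ g₂ hs.state hl hcur ht
        refine ⟨π', hag, hs', fun H => ⟨hcur', congrArg Term.lio (hr ?_)⟩⟩
        rcases H with H | H
        · exact H
        · exact hcur' ▸ H
    · exact (Eval.action ha).similar_of_high h₂ g₁ g₂ hs hl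

theorem State.WellTyped.inv {Δ : StoreTyping} {Γ : List Ty} {S : State L}
    (hS : S.WellTyped Δ Γ) : S.Inv A {a | S.Allocated a} := by
  have hfi : ∀ a c, S.fi a = some c → S.Allocated a := fun a c e => Or.inl (by simp [e])
  have hfs : ∀ a c, S.fs a = some c → S.Allocated a := fun a c e => Or.inr (by simp [e])
  refine ⟨fun a ha => ha, fun a l t e => ?_, fun a lo ld t e => ?_,
    fun a l t e ha => absurd (hfi _ _ e) ha, fun a lo ld t e ha => absurd (hfs _ _ e) ha,
    fun a l t e ha => absurd (hfi _ _ e) ha, fun a lo ld t e ha => absurd (hfs _ _ e) ha⟩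
  · obtain ⟨τ, hτ⟩ := Option.ne_none_iff_exists'.1
      (mt (hS.fi_dom a).1 (by simp [e]))
    exact (hS.fi_type a l t τ e hτ).closed hS
  · obtain ⟨τ, hτ⟩ := Option.ne_none_iff_exists'.1
      (mt (hS.fs_dom a).1 (by simp [e]))
    exact (hS.fs_type a lo ld t τ e hτ).closed hS

theorem State.Related.refl (S : State L) : State.Related A D 1 S S := by
  refine ⟨fun _ _ => rfl, fun a => ?_, fun a => ?_⟩ <;> simp [Term.rename_id]

theorem obsFI_rename (f : Addr → Addr) (o : Option (L × Term L)) :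
    obsFI A (o.map fun c => (c.1, c.2.rename f)) =
      (obsFI A o).map fun c => (c.1, c.2.rename f) := by
  rcases o with _ | ⟨l, t⟩
  · rfl
  · by_cases hl : l ≤ A <;> simp [obsFI, hl, Term.erase_rename]

theorem obsFS_rename (f : Addr → Addr) (o : Option (L × L × Term L)) :
    obsFS A (o.map fun c => (c.1, c.2.1, c.2.2.rename f)) =
      (obsFS A o).map fun c => (c.1, c.2.1, c.2.2.rename f) := by
  rcases o with _ | ⟨lo, ld, t⟩
  · rfl
  · by_cases hl : lo ≤ A <;> by_cases hd : ld ≤ A <;>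
      simp [obsFS, hl, hd, Term.erase_rename, Term.rename]

theorem Similar.lowEquiv {π : Equiv.Perm Addr} {S₁ S₂ : State L} {t₁ t₂ : Term L}
    (h : Similar A D π S₁ t₁ S₂ t₂) : Conf.LowEquiv A D ⟨S₁, t₁⟩ ⟨S₂, t₂⟩ := by
  refine ⟨π, h.state.fixes, ?_⟩
  have hfi : ∀ a, obsFI A (((Conf.mk S₁ t₁).rename π).state.fi a) = obsFI A (S₂.fi a) := by
    intro a
    have := h.state.fi (π.symm a)
    rw [Equiv.apply_symm_apply] at this
    rw [← this]
    exact obsFI_rename _ _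
  have hfs : ∀ a, obsFS A (((Conf.mk S₁ t₁).rename π).state.fs a) = obsFS A (S₂.fs a) := by
    intro a
    have := h.state.fs (π.symm a)
    rw [Equiv.apply_symm_apply] at this
    rw [← this]
    exact obsFS_rename _ _
  unfold Conf.erase
  congr 1
  · by_cases h₁ : S₁.cur ≤ A
    · obtain ⟨hcur, ht⟩ := h.term (Or.inl h₁)
      have h₂ : S₂.cur ≤ A := hcur ▸ h₁
      have ht' : (t₁.rename π).erase A = t₂.erase A := by rw [Term.erase_rename]; exact ht
      simp only [Conf.rename, ht', if_pos h₂, hcur]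
      exact if_pos h₁
    · have h₂ : ¬ S₂.cur ≤ A := fun h₂ => h₁ ((h.term (Or.inr h₂)).1 ▸ h₂)
      simp [Conf.rename, h₁, h₂]
  · exact funext hfi
  · exact funext hfs

end NonInterference

end FloatingLabel

theorem mainTheorem2 {L : Type*} [Lattice L] (A : L)
    (Δ : FloatingLabel.StoreTyping) (Γ : List FloatingLabel.Ty) (S : FloatingLabel.State L) (hS : S.WellTyped Δ Γ)
    (t₁ t₂ : FloatingLabel.Term L) (τ₁ τ₂ : FloatingLabel.Ty)
    (ht₁ : FloatingLabel.HasType Δ Γ t₁ τ₁) (ht₂ : FloatingLabel.HasType Δ Γ t₂ τ₂)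
    (hf₁ : t₁.RefFree) (hf₂ : t₂.RefFree)
    (heq : FloatingLabel.Term.LowEquiv A t₁ t₂)
    (S₁ S₂ : FloatingLabel.State L) (v₁ v₂ : FloatingLabel.Term L) (hv₁ : v₁.IsValue) (hv₂ : v₂.IsValue)
    (hrun₁ : FloatingLabel.Steps ⟨S, t₁⟩ ⟨S₁, v₁⟩) (hrun₂ : FloatingLabel.Steps ⟨S, t₂⟩ ⟨S₂, v₂⟩) :
    FloatingLabel.Conf.LowEquiv A {a | S.Allocated a} ⟨S₁, v₁⟩ ⟨S₂, v₂⟩ := by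
  have h₁ := hrun₁.eval hv₁
  have h₂ := hrun₂.eval hv₂
  have hi := hS.inv (A := A)
  have g : ∀ {t : FloatingLabel.Term L}, t.RefFree →
      S.Good A {a | S.Allocated a} t := fun hf =>
    ⟨hi, hf.allRefs, fun _ => (hf.allRefs (P := fun _ _ => True)).erase A⟩
  obtain ⟨π, -, hs⟩ := h₁.similar h₂ (g hf₁) (g hf₂) (π := 1)
    ⟨FloatingLabel.State.Related.refl S,
      fun _ => ⟨rfl, (FloatingLabel.Term.rename_id _).trans heq⟩⟩
  exact hs.lowEquiv
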